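/- Let $k$ be an algebraically closed field of characteristic $0$, let $E$ be an elliptic curve over $k$, and let $K=k(E)$ be its field of rational functions. The degree $\deg f$ of a nonzero $f\in K$ is its number of zeros on $E$, counted with multiplicities. The pre-Bloch group $B_2(K)$ is the quotient of the free abelian group on the symbols $[f]$, $f\in K\setminus\{0,1\}$, by the subgroup generated by the Abel five-term elements $$[x]-[y]+\left[\frac{y}{x}\right]+\left[\frac{1-x}{1-y}\right]-\left[\frac{1-x^{-1}}{1-y^{-1}}\right],\qquad x,y\in K\setminus\{0,1\},\ x\neq y,$$ and $\mathcal F_nB_2(K)\subseteq B_2(K)$ denotes the subgroup generated by the classes $[g]$ with $g\in K\setminus\{0,1\}$ and $\deg g\le n$. A rational function $f$ on $E$ is called generic if there are points $\alpha_1,\alpha_2\in f^{-1}(0)$, $\beta_1,\beta_2\in f^{-1}(1)$, $\gamma_1,\gamma_2\in f^{-1}(\infty)$ on $E$ such that 1. if $\alpha_1=\alpha_2$, then $f$ has a zero of multiplicity at least $2$ at $\alpha_1$, and if $\gamma_1=\gamma_2$, then $f$ has a pole of multiplicity at least $2$ at $\gamma_1$; 2. $\beta_1\ne\beta_2$; 3.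 the points $\alpha_1+\alpha_2$, $\beta_1+\beta_2$, $\gamma_1+\gamma_2$ are pairwise different; 4. the points $\alpha_1+\alpha_2-\gamma_1-\beta_1$ and $\alpha_1+\alpha_2-\gamma_1-\beta_2$ are nonzero. Proposition. Let $n\ge 3$ and let $f\in K$ be a generic function of degree $n+1$. Then the element $[f]$ lies in $\mathcal F_nB_2(K)$. -/

import Mathlib

noncomputable section

namespace EllipticBloch

open Polynomial
open scoped nonZeroDivisors

/-! ### The coordinate ring of an elliptic curve is a Dedekind domain -/

/-- A Noetherian domain whose nonzero prime ideals are invertible is a Dedekind domain. -/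
theorem isDedekindDomain_of_isUnit_prime {R : Type*} [CommRing R] [IsDomain R]
    [IsNoetherianRing R]
    (h : ∀ P : Ideal R, P.IsPrime → P ≠ ⊥ →
      IsUnit (P : FractionalIdeal R⁰ (FractionRing R))) :
    IsDedekindDomain R := by
  have key : ∀ I : Ideal R, I ≠ ⊥ → IsUnit (I : FractionalIdeal R⁰ (FractionRing R)) := by
    intro I
    induction I using IsNoetherian.induction with
    | hgt I ih =>
      intro hI
      by_cases htop : I = ⊤
      · rw [htop, FractionalIdeal.coeIdeal_top]
        exact isUnit_one
      obtain ⟨P, hP, hIP⟩ := Ideal.exists_le_maximal I htop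
      have hP0 : P ≠ ⊥ := fun h0 => hI (le_bot_iff.mp (h0 ▸ hIP))
      obtain ⟨u, hu⟩ := h P hP.isPrime hP0
      have hle : (I : FractionalIdeal R⁰ (FractionRing R)) * (u⁻¹ : _ˣ).1 ≤ 1 := by
        have h1 : (I : FractionalIdeal R⁰ (FractionRing R)) ≤ u := by
          rw [hu]
          exact (FractionalIdeal.coeIdeal_le_coeIdeal _).mpr hIP
        calc (I : FractionalIdeal R⁰ (FractionRing R)) * (u⁻¹ : _ˣ).1
            ≤ u * (u⁻¹ : _ˣ).1 := by gcongr
          _ = 1 := u.mul_inv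
      obtain ⟨J, hJ⟩ := FractionalIdeal.le_one_iff_exists_coeIdeal.mp hle
      have hIJ' : (I : FractionalIdeal R⁰ (FractionRing R)) = J * P := by
        rw [hJ, ← hu, mul_assoc, u.inv_mul, mul_one]
      have hIJ : I = J * P := by
        apply FractionalIdeal.coeIdeal_injective (K := FractionRing R)
        simpa [FractionalIdeal.coeIdeal_mul] using hIJ'
      have hJ0 : J ≠ ⊥ := by
        rintro rfl
        exact hI (by simpa using hIJ)
      have hlt : I < J := by
        refine lt_of_le_of_ne ((hIJ.le.trans (Ideal.mul_le_inf.trans inf_le_left))) ?_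
        intro hEq
        have hN : J ≤ P • J := by
          rw [smul_eq_mul, mul_comm, ← hIJ, hEq]
        obtain ⟨r, hr1, hr2⟩ :=
          Submodule.exists_sub_one_mem_and_smul_eq_zero_of_fg_of_le_smul P J
            (IsNoetherian.noetherian J) hN
        obtain ⟨j, hj, hj0⟩ := Submodule.exists_mem_ne_zero_of_ne_bot hJ0
        have hr : r = 0 := by
          have := hr2 j hj
          rw [smul_eq_mul] at this
          exact (mul_eq_zero.mp this).resolve_right hj0
        apply hP.ne_top
        rw [Ideal.eq_top_iff_one]
        rw [hr, zero_sub] at hr1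
        simpa using P.neg_mem hr1
      rw [hIJ']
      exact (ih J hlt hJ0).mul ⟨u, hu⟩
  rw [isDedekindDomain_iff_mul_inv_cancel (K := FractionRing R)]
  intro I hI
  rw [FractionalIdeal.mul_inv_cancel_iff_isUnit]
  obtain ⟨a, J, ha, hIJ⟩ := FractionalIdeal.exists_eq_spanSingleton_mul I
  have hJ0 : J ≠ ⊥ := by
    rintro rfl
    apply hI
    simp [hIJ]
  rw [hIJ]
  refine IsUnit.mul ?_ (key J hJ0)
  rw [← FractionalIdeal.mul_inv_cancel_iff_isUnit]
  apply FractionalIdeal.spanSingleton_mul_inv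
  simpa using ha

variable {k : Type*} [Field k]

open WeierstrassCurve.Affine

theorem XYIdeal_isMaximal (W : WeierstrassCurve.Affine k) {x y : k} (h : W.Equation x y) :
    (CoordinateRing.XYIdeal W x (C y)).IsMaximal := by
  have h' : (W.polynomial.eval (C y)).eval x = 0 := h
  exact Ideal.Quotient.maximal_of_isField _
    ((CoordinateRing.quotientXYIdealEquiv h').toMulEquiv.isField (Field.toIsField k))

theorem XYIdeal_ne_bot (W : WeierstrassCurve.Affine k) (x : k) (y : k[X]) :
    CoordinateRing.XYIdeal W x y ≠ ⊥ := by
  intro h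
  apply CoordinateRing.XClass_ne_zero (W' := W) x
  rw [← Ideal.mem_bot, ← h]
  exact Ideal.subset_span (by simp)

instance instIsNoetherianRing (W : WeierstrassCurve.Affine k) :
    IsNoetherianRing W.CoordinateRing :=
  inferInstanceAs (IsNoetherianRing (k[X][X] ⧸ Ideal.span {W.polynomial}))

/-- Over an algebraically closed field, every nonzero prime ideal of the coordinate ring is the
ideal of an affine point of the curve. -/
theorem exists_XYIdeal_eq [IsAlgClosed k] (W : WeierstrassCurve.Affine k)
    (P : Ideal W.CoordinateRing) [P.IsPrime] (hP : P ≠ ⊥) :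
    ∃ x y : k, W.Equation x y ∧ P = CoordinateRing.XYIdeal W x (C y) := by
  have hint : Algebra.IsIntegral k[X] W.CoordinateRing :=
    haveI : Module.Finite k[X] W.CoordinateRing := .of_basis (CoordinateRing.basis W)
    Algebra.IsIntegral.of_finite _ _
  obtain ⟨z, hzP, hz⟩ := Submodule.exists_mem_ne_zero_of_ne_bot hP
  have hc : P.comap (algebraMap k[X] W.CoordinateRing) ≠ ⊥ :=
    Ideal.comap_ne_bot_of_integral_mem hz hzP (hint.isIntegral z)
  have hcm : (P.comap (algebraMap k[X] W.CoordinateRing)).IsMaximal :=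
    (Ideal.comap_isPrime _ P).isMaximal hc
  have hPm : P.IsMaximal := Ideal.isMaximal_of_isIntegral_of_isMaximal_comap P hcm
  let : Field (W.CoordinateRing ⧸ P) := Ideal.Quotient.field P
  have hft : Algebra.FiniteType k (W.CoordinateRing ⧸ P) := by
    have h1 : Algebra.FiniteType k W.CoordinateRing := by
      have : Module.Finite k[X] W.CoordinateRing := .of_basis (CoordinateRing.basis W)
      exact Algebra.FiniteType.trans (S := k[X]) inferInstance inferInstance
    exact h1.of_surjective (Ideal.Quotient.mkₐ k P) (Ideal.Quotient.mkₐ_surjective k P)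
  have hfin : Module.Finite k (W.CoordinateRing ⧸ P) :=
    finite_of_finite_type_of_isJacobsonRing k _
  have hbij : Function.Bijective (algebraMap k (W.CoordinateRing ⧸ P)) :=
    IsAlgClosed.algebraMap_bijective_of_isIntegral
  obtain ⟨x, hx⟩ := hbij.2 (Ideal.Quotient.mk P (CoordinateRing.mk W (C X)))
  obtain ⟨y, hy⟩ := hbij.2 (Ideal.Quotient.mk P (CoordinateRing.mk W X))
  have hle : CoordinateRing.XYIdeal W x (C y) ≤ P := by
    rw [CoordinateRing.XYIdeal, Ideal.span_le]
    rintro _ (rfl | rfl)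
    · rw [SetLike.mem_coe, ← Ideal.Quotient.eq_zero_iff_mem, CoordinateRing.XClass, C_sub,
        map_sub, map_sub, ← hx, sub_eq_zero]
      rfl
    · rw [SetLike.mem_coe, ← Ideal.Quotient.eq_zero_iff_mem, CoordinateRing.YClass,
        map_sub, map_sub, ← hy, sub_eq_zero]
      rfl
  have heq : W.Equation x y := by
    have hcomp : (algebraMap k (W.CoordinateRing ⧸ P)).comp (evalEvalRingHom x y) =
        (Ideal.Quotient.mk P).comp (CoordinateRing.mk W) := by
      refine Polynomial.ringHom_ext' (Polynomial.ringHom_ext' ?_ ?_) ?_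
      · ext a
        simp
        rfl
      · simpa using hx
      · simpa using hy
    have h0 := congrArg (fun φ => φ W.polynomial) hcomp
    simp only [RingHom.comp_apply, CoordinateRing.mk, AdjoinRoot.mk_self, map_zero] at h0
    exact hbij.1 (h0.trans (map_zero _).symm)
  exact ⟨x, y, heq, ((XYIdeal_isMaximal W heq).eq_of_le hPm.ne_top hle).symm⟩

instance instIsDedekindDomain [IsAlgClosed k] (W : WeierstrassCurve.Affine k)
    [WeierstrassCurve.IsElliptic W] : IsDedekindDomain W.CoordinateRing :=
  isDedekindDomain_of_isUnit_prime fun P hP hP0 => by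
    obtain ⟨x, y, h, rfl⟩ := exists_XYIdeal_eq W P hP0
    exact ⟨CoordinateRing.XYIdeal' (equation_iff_nonsingular.mp h), rfl⟩

/-! ### Orders of vanishing and degrees of rational functions -/

section Order

variable [IsAlgClosed k] (W : WeierstrassCurve.Affine k) [WeierstrassCurve.IsElliptic W]

/-- The maximal ideal `(X - x, Y - y)` of the coordinate ring attached to an affine point
`(x, y)` of the curve. -/
def affinePlace {x y : k} (h : W.Nonsingular x y) :
    IsDedekindDomain.HeightOneSpectrum W.CoordinateRing where
  asIdeal := CoordinateRing.XYIdeal W x (C y)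
  isPrime := (XYIdeal_isMaximal W h.left).isPrime
  ne_bot := XYIdeal_ne_bot W x (C y)

open scoped RatFunc in
/-- The order `ord_P(f)` of a nonzero rational function `f` at a point `P` of the curve: positive
at zeros and negative at poles (and `0` by convention for `f = 0`).

At an affine point it is the adic valuation of the maximal ideal of that point, written
additively. The point at infinity is the only point of the curve over `x = ∞`, so the order of `f`
there is the order at `x = ∞`, that is, minus the degree, of the norm of `f` to `k(x)`. -/
def ord (P : W.Point) (f : W.FunctionField) : ℤ :=
  match P with
  | .zero => -(Algebra.norm (RatFunc k) f).intDegree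
  | .some _ _ h => -((affinePlace W h).valuation W.FunctionField f).log

/-- The degree of a nonzero rational function: its number of zeros, counted with
multiplicities. -/
def degree (f : W.FunctionField) : ℕ := ∑ᶠ P : W.Point, (ord W P f).toNat

/-- The rational function `f` takes the value `c` at the point `P`. -/
def TakesValue (f : W.FunctionField) (P : W.Point) (c : k) : Prop :=
  f = algebraMap k W.FunctionField c ∨ 0 < ord W P (f - algebraMap k W.FunctionField c)

/-- The rational function `f` takes the value `∞` at the point `P`. -/
def HasPole (f : W.FunctionField) (P : W.Point) : Prop := ord W P f < 0

/-- Generic rational functions. -/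
def IsGeneric [DecidableEq k] (f : W.FunctionField) : Prop :=
  ∃ α₁ α₂ β₁ β₂ γ₁ γ₂ : W.Point,
    (TakesValue W f α₁ 0 ∧ TakesValue W f α₂ 0) ∧
    (TakesValue W f β₁ 1 ∧ TakesValue W f β₂ 1) ∧
    (HasPole W f γ₁ ∧ HasPole W f γ₂) ∧
    ((α₁ = α₂ → 2 ≤ ord W α₁ f) ∧ (γ₁ = γ₂ → ord W γ₁ f ≤ -2)) ∧
    β₁ ≠ β₂ ∧
    (α₁ + α₂ ≠ β₁ + β₂ ∧ α₁ + α₂ ≠ γ₁ + γ₂ ∧ β₁ + β₂ ≠ γ₁ + γ₂) ∧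
    (α₁ + α₂ - γ₁ - β₁ ≠ 0 ∧ α₁ + α₂ - γ₁ - β₂ ≠ 0)

end Order

/-! ### The pre-Bloch group of a field -/

section PreBloch

/-- The set `F \ {0, 1}`. -/
abbrev Gen (F : Type*) [Field F] : Type _ := {f : F // f ≠ 0 ∧ f ≠ 1}

variable {F : Type*} [Field F]

/-- The element `y / x` of `F \ {0, 1}`, for `x ≠ y`. -/
def Gen.ratio (x y : Gen F) (h : x ≠ y) : Gen F :=
  ⟨y.1 / x.1, div_ne_zero y.2.1 x.2.1, fun e =>
    h (Subtype.ext ((div_eq_one_iff_eq x.2.1).mp e).symm)⟩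

/-- The element `1 - x` of `F \ {0, 1}`. -/
def Gen.oneSub (x : Gen F) : Gen F :=
  ⟨1 - x.1, sub_ne_zero.mpr x.2.2.symm, fun e => x.2.1 (by simpa using e)⟩

/-- The element `x⁻¹` of `F \ {0, 1}`. -/
def Gen.inverse (x : Gen F) : Gen F :=
  ⟨x.1⁻¹, inv_ne_zero x.2.1, fun e => x.2.2 (by simpa using e)⟩

theorem Gen.oneSub_injective : Function.Injective (Gen.oneSub (F := F)) := fun _ _ h =>
  Subtype.ext (sub_right_injective (congrArg Subtype.val h))

theorem Gen.inverse_injective : Function.Injective (Gen.inverse (F := F)) := fun _ _ h =>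
  Subtype.ext (inv_injective (congrArg Subtype.val h))

/-- The Abel five-term element
`[x] - [y] + [y / x] + [(1 - x) / (1 - y)] - [(1 - x⁻¹) / (1 - y⁻¹)]`. -/
def fiveTerm (x y : Gen F) (h : x ≠ y) : FreeAbelianGroup (Gen F) :=
  .of x - .of y + .of (Gen.ratio x y h)
    + .of (Gen.ratio y.oneSub x.oneSub (Gen.oneSub_injective.ne h.symm))
    - .of (Gen.ratio y.inverse.oneSub x.inverse.oneSub
        (Gen.oneSub_injective.ne (Gen.inverse_injective.ne h.symm)))

variable (F) in
/-- The subgroup generated by the Abel five-term elements. -/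
def fiveTermSubgroup : AddSubgroup (FreeAbelianGroup (Gen F)) :=
  AddSubgroup.closure {z | ∃ (x y : Gen F) (h : x ≠ y), z = fiveTerm x y h}

variable (F) in
/-- The pre-Bloch group `B₂(F)`. -/
abbrev PreBloch : Type _ := FreeAbelianGroup (Gen F) ⧸ fiveTermSubgroup F

/-- The class `[f]` in the pre-Bloch group. -/
def PreBloch.mk (f : Gen F) : PreBloch F :=
  QuotientAddGroup.mk (FreeAbelianGroup.of f)

end PreBloch

/-- The subgroup `F_n B₂(K)` generated by the elements `[f]` with `deg f ≤ n`, where `K` is the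
function field of the curve. -/
def filtration [IsAlgClosed k] (W : WeierstrassCurve.Affine k) [WeierstrassCurve.IsElliptic W]
    (n : ℕ) : AddSubgroup (PreBloch W.FunctionField) :=
  AddSubgroup.closure {z | ∃ f : Gen W.FunctionField, degree W f.1 ≤ n ∧ z = PreBloch.mk f}

end EllipticBloch

end

noncomputable section

namespace EllipticBloch

open Polynomial WeierstrassCurve.Affine IsDedekindDomain
open scoped nonZeroDivisors RatFunc

variable {k : Type*} [Field k]

/-! The heart of the argument is one auxiliary function `g` of degree at most 3 sharing two zeros,
two poles and two ones with `f`: div(g) = α₁ + α₂ + δ - γ₁ - γ₂ - ε and div(1 - g) = β₁ + β₂ + ζ -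
γ₁ - γ₂ - ε. In the five-term relation for `x = f`, `y = g`, each of g/f, (1 - f)/(1 - g) and (1 -
f⁻¹)/(1 - g⁻¹) is a quotient in which two of the n + 1 points cancel on either side and one new
point appears, so its degree is at most n + 1 - 2 + 1 = n. As `g` has degree at most 3 ≤ n, the
relation expresses [f] through classes of degree at most n.

The function is g = p/q (`exists_auxiliary`). Take `h` with simple poles at β₁, β₂, and `q` with the
same polar parts there, zeros at γ₁, γ₂ and otherwise at most the poles α₁, α₂
(`exists_same_polar_part`; this needs α₁ + α₂ ≠ γ₁ + γ₂). For any constant c and p = h - c, the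
numerator of 1 - p/q = (q - h + c)/q is regular at β₁, β₂, so g = 1 there. Besides γ₁, γ₂, `q` has
two more zeros τ, τ'; choosing c = h(τ) cancels τ and leaves degree at most 3.

The geometric input is that orders are discrete valuations with residue field `k` (`le_ord_add`,
`exists_sub_ord_pos`), that principal divisors have degree zero (`finsum_ord`), and Abel's criterion
for a divisor to be principal (`exists_ord_eq`), which comes from the homomorphism from points to
the class group of the coordinate ring. -/

theorem finite_coordinateRing (W : WeierstrassCurve.Affine k) :
    Module.Finite k[X] W.CoordinateRing :=
  .of_basis (CoordinateRing.basis W)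

attribute [local instance] finite_coordinateRing

/-! ### The norm of a rational function to `k(x)` -/

/-- The norm of p + qY has degree max(2 deg p, 2 deg q + 3), and both entries are ultrametric in p
and q. This is the valuation inequality at infinity before denominators are introduced. -/
theorem degree_norm_add_le (W : WeierstrassCurve.Affine k) (r s : W.CoordinateRing) :
    (Algebra.norm k[X] (r + s)).degree ≤
      max (Algebra.norm k[X] r).degree (Algebra.norm k[X] s).degree := by
  obtain ⟨p, q, rfl⟩ := CoordinateRing.exists_smul_basis_eq r
  obtain ⟨p', q', rfl⟩ := CoordinateRing.exists_smul_basis_eq s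
  have h : p • (1 : W.CoordinateRing) + q • CoordinateRing.mk W X +
      (p' • (1 : W.CoordinateRing) + q' • CoordinateRing.mk W X) =
      (p + p') • (1 : W.CoordinateRing) + (q + q') • CoordinateRing.mk W X := by
    simp only [add_smul]; abel
  rw [h]
  simp only [CoordinateRing.degree_norm_smul_basis]
  apply max_le
  · rcases le_max_iff.mp (degree_add_le p p') with h | h
    · exact le_max_of_le_left (le_max_of_le_left (nsmul_le_nsmul_right h 2))
    · exact le_max_of_le_right (le_max_of_le_left (nsmul_le_nsmul_right h 2))
  · rcases le_max_iff.mp (degree_add_le q q') with h | h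
    · refine le_max_of_le_left (le_max_of_le_right ?_)
      gcongr
    · refine le_max_of_le_right (le_max_of_le_right ?_)
      gcongr

/-- The residue field at infinity is `k`: if r/d has no pole there, its value is the ratio of the
coefficients of X^(deg d) in the Y-free part of r and in d. -/
theorem exists_degree_norm_sub_lt (W : WeierstrassCurve.Affine k) (r : W.CoordinateRing) (d : k[X])
    (hd : d ≠ 0) (h : (Algebra.norm k[X] r).degree ≤ 2 • d.degree) :
    ∃ c : k, (Algebra.norm k[X] (r - algebraMap k[X] _ (C c * d))).degree < 2 • d.degree := by
  obtain ⟨p, q, rfl⟩ := CoordinateRing.exists_smul_basis_eq r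
  rw [CoordinateRing.degree_norm_smul_basis, max_le_iff] at h
  refine ⟨p.coeff d.natDegree / d.leadingCoeff, ?_⟩
  set c := p.coeff d.natDegree / d.leadingCoeff with hc
  have h' : p • (1 : W.CoordinateRing) + q • CoordinateRing.mk W X - algebraMap k[X] _ (C c * d) =
      (p - C c * d) • (1 : W.CoordinateRing) + q • CoordinateRing.mk W X := by
    rw [sub_smul, Algebra.algebraMap_eq_smul_one (C c * d)]; abel
  rw [h', CoordinateRing.degree_norm_smul_basis]
  have hdd := degree_eq_natDegree hd
  have hp : p.degree ≤ d.natDegree := by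
    have := h.1
    rw [hdd] at this
    rcases eq_or_ne p 0 with rfl | hp0
    · simp
    rw [degree_eq_natDegree hp0] at this ⊢
    simp only [two_nsmul] at this ⊢
    norm_cast at this ⊢
    omega
  have hlt : (p - C c * d).degree < d.natDegree := by
    rw [degree_lt_iff_coeff_zero]
    intro m hm
    rcases hm.eq_or_lt with rfl | hm
    · rw [coeff_sub, coeff_C_mul, hc, coeff_natDegree,
        div_mul_cancel₀ _ (leadingCoeff_ne_zero.mpr hd), sub_self]
    · rw [coeff_sub, coeff_C_mul, coeff_eq_zero_of_natDegree_lt hm,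
        coeff_eq_zero_of_degree_lt (hp.trans_lt (by exact_mod_cast hm))]
      simp
  apply max_lt
  · rw [hdd]
    generalize p - C c * d = s at *
    rcases eq_or_ne s 0 with rfl | hs
    · simp only [degree_zero, two_nsmul]
      rw [WithBot.bot_add]
      exact_mod_cast WithBot.bot_lt_coe _
    rw [degree_eq_natDegree hs] at hlt ⊢
    simp only [two_nsmul]
    norm_cast at hlt ⊢
    omega
  -- The Y-part needs no correction: 2 deg q + 3 is odd, so it cannot equal 2 deg d and the
  -- inequality is already strict.
  · have := h.2
    rw [hdd] at this ⊢
    rcases eq_or_ne q 0 with rfl | hq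
    · simp only [degree_zero, two_nsmul]
      rw [WithBot.bot_add, WithBot.bot_add]
      exact_mod_cast WithBot.bot_lt_coe _
    rw [degree_eq_natDegree hq] at this ⊢
    simp only [two_nsmul] at this ⊢
    norm_cast at this ⊢
    omega

/-! ### The function field as a finite extension of k(x) -/

section

variable [IsAlgClosed k] (W : WeierstrassCurve.Affine k) [WeierstrassCurve.IsElliptic W]

/-- The coordinate ring, being Dedekind, is the integral closure of k[X] in the function field;
hence denominators can always be taken in k[X], which makes norms to k(x) computable. -/
theorem isLocalization_functionField :
    IsLocalization (Algebra.algebraMapSubmonoid W.CoordinateRing k[X]⁰) W.FunctionField := by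
  have : IsIntegralClosure W.CoordinateRing k[X] W.FunctionField :=
    IsIntegralClosure.of_isIntegrallyClosed _ _ _
  have : Algebra.IsAlgebraic k[X] W.FunctionField :=
    have : Algebra.IsAlgebraic k[X] W.CoordinateRing := inferInstance
    (IsFractionRing.isAlgebraic_iff' k[X] W.CoordinateRing W.FunctionField).mp inferInstance
  have : Algebra.IsAlgebraic (RatFunc k) W.FunctionField :=
    (IsFractionRing.comap_isAlgebraic_iff (A := k[X])).mp inferInstance
  exact IsIntegralClosure.isLocalization k[X] (RatFunc k) W.FunctionField W.CoordinateRing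

attribute [local instance] isLocalization_functionField

theorem finite_functionField : Module.Finite (RatFunc k) W.FunctionField :=
  Module.Finite.of_isLocalization k[X] W.CoordinateRing k[X]⁰

attribute [local instance] finite_functionField

variable {W}

theorem exists_eq_div (f : W.FunctionField) : ∃ (r : W.CoordinateRing) (d : k[X]), d ≠ 0 ∧
    f = algebraMap _ _ r / algebraMap k[X] _ d := by
  obtain ⟨r, ⟨_, d, hd, rfl⟩, rfl⟩ := IsLocalization.exists_mk'_eq
    (Algebra.algebraMapSubmonoid W.CoordinateRing k[X]⁰) f
  refine ⟨r, d, nonZeroDivisors.ne_zero hd, ?_⟩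
  have hd' : algebraMap k[X] W.FunctionField d ≠ 0 := by
    rw [Ne, FaithfulSMul.algebraMap_eq_zero_iff]
    exact nonZeroDivisors.ne_zero hd
  rw [eq_div_iff hd', IsScalarTower.algebraMap_apply k[X] W.CoordinateRing W.FunctionField]
  exact IsLocalization.mk'_spec _ _ _

theorem norm_algebraMap_coordinateRing (r : W.CoordinateRing) :
    Algebra.norm (RatFunc k) (algebraMap W.CoordinateRing W.FunctionField r) =
      algebraMap k[X] (RatFunc k) (Algebra.norm k[X] r) :=
  Algebra.norm_localization k[X] k[X]⁰ r

theorem ord_zero_algebraMap (r : W.CoordinateRing) :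
    ord W .zero (algebraMap _ _ r) = -((Algebra.norm k[X] r).natDegree : ℤ) := by
  rw [ord, norm_algebraMap_coordinateRing, RatFunc.intDegree_polynomial]

/-! ### The order of vanishing is a valuation with residue field `k` -/

theorem ord_mul (P : W.Point) {f g : W.FunctionField} (hf : f ≠ 0) (hg : g ≠ 0) :
    ord W P (f * g) = ord W P f + ord W P g := by
  cases P with
  | zero =>
    have h1 := (Algebra.norm_ne_zero_iff (R := RatFunc k)).mpr hf
    have h2 := (Algebra.norm_ne_zero_iff (R := RatFunc k)).mpr hg
    simp only [ord, map_mul, RatFunc.intDegree_mul h1 h2, neg_add]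
  | some x y h =>
    have h1 := ((affinePlace W h).valuation W.FunctionField).ne_zero_iff.mpr hf
    have h2 := ((affinePlace W h).valuation W.FunctionField).ne_zero_iff.mpr hg
    simp only [ord, map_mul, WithZero.log_mul h1 h2, neg_add]

theorem ord_one (P : W.Point) : ord W P 1 = 0 := by
  have := ord_mul P (one_ne_zero (α := W.FunctionField)) one_ne_zero
  rw [mul_one] at this
  omega

theorem ord_inv (P : W.Point) (f : W.FunctionField) : ord W P f⁻¹ = -ord W P f := by
  rcases eq_or_ne f 0 with rfl | hf
  · have : ord W P (0 : W.FunctionField) = 0 := by cases P <;> simp [ord]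
    simp [this]
  have := ord_mul P hf (inv_ne_zero hf)
  rw [mul_inv_cancel₀ hf, ord_one] at this
  omega

theorem ord_div (P : W.Point) {f g : W.FunctionField} (hf : f ≠ 0) (hg : g ≠ 0) :
    ord W P (f / g) = ord W P f - ord W P g := by
  rw [div_eq_mul_inv, ord_mul P hf (inv_ne_zero hg), ord_inv, sub_eq_add_neg]

theorem ord_neg (P : W.Point) (f : W.FunctionField) : ord W P (-f) = ord W P f := by
  rcases eq_or_ne f 0 with rfl | hf
  · rw [neg_zero]
  have h := ord_mul P (neg_ne_zero.mpr hf) (neg_ne_zero.mpr hf)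
  rw [neg_mul_neg, ord_mul P hf hf] at h
  omega

theorem ord_zero_div {r : W.CoordinateRing} {d : k[X]} (hr : r ≠ 0) (hd : d ≠ 0) :
    ord W .zero (algebraMap _ _ r / algebraMap k[X] _ d) =
      2 * (d.natDegree : ℤ) - (Algebra.norm k[X] r).natDegree := by
  have hd' : algebraMap k[X] W.CoordinateRing d ≠ 0 := by
    rwa [Ne, FaithfulSMul.algebraMap_eq_zero_iff]
  rw [IsScalarTower.algebraMap_apply k[X] W.CoordinateRing W.FunctionField, ord_div,
    ord_zero_algebraMap, ord_zero_algebraMap, Algebra.norm_algebraMap_of_basis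
      (CoordinateRing.basis W), natDegree_pow]
  · simp; ring
  · rwa [Ne, FaithfulSMul.algebraMap_eq_zero_iff]
  · rwa [Ne, FaithfulSMul.algebraMap_eq_zero_iff]

theorem ord_algebraMap (P : W.Point) (c : k) : ord W P (algebraMap k _ c) = 0 := by
  rcases eq_or_ne c 0 with rfl | hc
  · rw [map_zero]; cases P <;> simp [ord]
  cases P with
  | zero =>
    rw [IsScalarTower.algebraMap_apply k W.CoordinateRing W.FunctionField, ord_zero_algebraMap,
      IsScalarTower.algebraMap_apply k k[X] W.CoordinateRing, Algebra.norm_algebraMap_of_basis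
        (CoordinateRing.basis W)]
    simp
  | some x y h =>
    have h1 : ∀ a : k, (affinePlace W h).valuation W.FunctionField (algebraMap k _ a) ≤ 1 := by
      intro a
      rw [IsScalarTower.algebraMap_apply k W.CoordinateRing W.FunctionField]
      exact HeightOneSpectrum.valuation_le_one _ _
    have h2 := h1 c⁻¹
    rw [map_inv₀, map_inv₀] at h2
    have h0 := ((affinePlace W h).valuation W.FunctionField).ne_zero_iff.mpr
      ((map_ne_zero (algebraMap k W.FunctionField)).mpr hc)
    have : (affinePlace W h).valuation W.FunctionField (algebraMap k _ c) = 1 :=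
      le_antisymm (h1 c) ((inv_le_one₀ (zero_lt_iff.mpr h0)).mp h2)
    simp [ord, this]

/-- The alternatives "= 0" replace the value +∞ at zero, because `ord` assigns 0 to the zero
function. -/
theorem le_ord_add (P : W.Point) {f g : W.FunctionField} {m : ℤ} (hf : f = 0 ∨ m ≤ ord W P f)
    (hg : g = 0 ∨ m ≤ ord W P g) : f + g = 0 ∨ m ≤ ord W P (f + g) := by
  rcases eq_or_ne f 0 with rfl | hf0
  · simpa using hg
  rcases eq_or_ne g 0 with rfl | hg0
  · simpa using hf
  rcases eq_or_ne (f + g) 0 with h0 | h0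
  · exact .inl h0
  have hf := hf.resolve_left hf0
  have hg := hg.resolve_left hg0
  refine .inr ?_
  cases P with
  | zero =>
    obtain ⟨r, d, hd, rfl⟩ := exists_eq_div f
    obtain ⟨r', d', hd', rfl⟩ := exists_eq_div g
    have hdK : algebraMap k[X] W.FunctionField d ≠ 0 := by
      rwa [Ne, FaithfulSMul.algebraMap_eq_zero_iff]
    have hdK' : algebraMap k[X] W.FunctionField d' ≠ 0 := by
      rwa [Ne, FaithfulSMul.algebraMap_eq_zero_iff]
    -- Over a common denominator the claim becomes the inequality for norms of elements of the
    -- coordinate ring.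
    have e1 : algebraMap W.CoordinateRing W.FunctionField r / algebraMap k[X] _ d =
        algebraMap W.CoordinateRing W.FunctionField (r * algebraMap k[X] _ d') /
          algebraMap k[X] _ (d * d') := by
      rw [map_mul, map_mul, ← IsScalarTower.algebraMap_apply, mul_div_mul_right _ _ hdK']
    have e2 : algebraMap W.CoordinateRing W.FunctionField r' / algebraMap k[X] _ d' =
        algebraMap W.CoordinateRing W.FunctionField (r' * algebraMap k[X] _ d) /
          algebraMap k[X] _ (d * d') := by
      rw [map_mul, map_mul, ← IsScalarTower.algebraMap_apply, mul_comm (algebraMap k[X] _ d),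
        mul_div_mul_right _ _ hdK]
    rw [e1, e2, ← add_div, ← map_add] at h0 ⊢
    rw [e1] at hf hf0
    rw [e2] at hg hg0
    generalize r * algebraMap k[X] _ d' = s at *
    generalize r' * algebraMap k[X] _ d = s' at *
    have hs : s ≠ 0 := by rintro rfl; simp at hf0
    have hs' : s' ≠ 0 := by rintro rfl; simp at hg0
    have hss : s + s' ≠ 0 := by intro h; simp [h] at h0
    rw [ord_zero_div ‹_› (mul_ne_zero hd hd')] at hf hg ⊢
    have key := degree_norm_add_le W s s'
    rw [degree_eq_natDegree (Algebra.norm_ne_zero_iff (R := k[X]).mpr hs),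
      degree_eq_natDegree (Algebra.norm_ne_zero_iff (R := k[X]).mpr hs'),
      degree_eq_natDegree (Algebra.norm_ne_zero_iff (R := k[X]).mpr hss)] at key
    rcases le_max_iff.mp key with key | key <;> norm_cast at key <;> omega
  | some x y h =>
    have hv := ((affinePlace W h).valuation W.FunctionField).map_add f g
    have h1 := ((affinePlace W h).valuation W.FunctionField).ne_zero_iff.mpr hf0
    have h2 := ((affinePlace W h).valuation W.FunctionField).ne_zero_iff.mpr hg0
    have h3 := ((affinePlace W h).valuation W.FunctionField).ne_zero_iff.mpr h0
    simp only [ord] at hf hg ⊢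
    rcases le_max_iff.mp hv with hv | hv
    · rw [← WithZero.log_le_log h3 h1] at hv; omega
    · rw [← WithZero.log_le_log h3 h2] at hv; omega

theorem exists_sub_ord_pos (P : W.Point) {f : W.FunctionField} (hf : 0 ≤ ord W P f) :
    ∃ c : k, f - algebraMap k _ c = 0 ∨ 0 < ord W P (f - algebraMap k _ c) := by
  rcases eq_or_ne f 0 with rfl | hf0
  · exact ⟨0, by simp⟩
  cases P with
  | zero =>
    obtain ⟨r, d, hd, rfl⟩ := exists_eq_div f
    have hr : r ≠ 0 := by rintro rfl; simp at hf0
    rw [ord_zero_div hr hd] at hf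
    obtain ⟨c, hc⟩ := exists_degree_norm_sub_lt W r d hd (by
      rw [degree_eq_natDegree hd, degree_eq_natDegree (Algebra.norm_ne_zero_iff (R := k[X]).mpr hr)]
      simp only [two_nsmul]
      norm_cast
      omega)
    have hdK : algebraMap k[X] W.FunctionField d ≠ 0 := by
      rwa [Ne, FaithfulSMul.algebraMap_eq_zero_iff]
    have e : algebraMap W.CoordinateRing W.FunctionField r / algebraMap k[X] _ d -
        algebraMap k _ c = algebraMap W.CoordinateRing W.FunctionField
          (r - algebraMap k[X] _ (C c * d)) / algebraMap k[X] _ d := by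
      rw [map_sub, ← IsScalarTower.algebraMap_apply, map_mul, sub_div, mul_div_cancel_right₀ _ hdK,
        IsScalarTower.algebraMap_apply k k[X] W.FunctionField]
      rfl
    refine ⟨c, ?_⟩
    rw [e]
    generalize r - algebraMap k[X] _ (C c * d) = s at *
    rcases eq_or_ne s 0 with rfl | hs
    · simp
    right
    rw [ord_zero_div hs hd]
    rw [degree_eq_natDegree hd, degree_eq_natDegree (Algebra.norm_ne_zero_iff (R := k[X]).mpr hs)] at hc
    simp only [two_nsmul] at hc
    norm_cast at hc
    omega
  | some x y h =>
    have hv0 := ((affinePlace W h).valuation W.FunctionField).ne_zero_iff.mpr hf0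
    have hv : (affinePlace W h).valuation W.FunctionField f ≤ 1 := by
      rw [← WithZero.log_le_log hv0 one_ne_zero, WithZero.log_one]
      simpa [ord] using hf
    -- Approximate f modulo the maximal ideal by a regular function a; the residue of a is a
    -- constant because the quotient by the ideal of a point is `k`.
    obtain ⟨a, ha⟩ := (affinePlace W h).exists_valuation_sub_lt_of_integer hv 1
    obtain ⟨c, hc⟩ : ∃ c : k, a - algebraMap k _ c ∈ (affinePlace W h).asIdeal := by
      let e := CoordinateRing.quotientXYIdealEquiv (W' := W) (x := x) (y := C y) h.left
      refine ⟨e (Ideal.Quotient.mk _ a), ?_⟩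
      change _ ∈ CoordinateRing.XYIdeal W x (C y)
      rw [← Ideal.Quotient.eq_zero_iff_mem, map_sub, sub_eq_zero]
      apply e.injective
      exact (e.commutes _).symm
    refine ⟨c, ?_⟩
    rcases eq_or_ne (f - algebraMap k W.FunctionField c) 0 with h0 | h0
    · exact .inl h0
    right
    have h3 := ((affinePlace W h).valuation W.FunctionField).ne_zero_iff.mpr h0
    rw [ord, neg_pos, ← WithZero.log_one, WithZero.log_lt_log h3 one_ne_zero]
    have e : f - algebraMap k W.FunctionField c =
        algebraMap _ _ (a - algebraMap k _ c) - (algebraMap _ _ a - f) := by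
      rw [map_sub, ← IsScalarTower.algebraMap_apply]
      ring
    rw [e]
    refine Valuation.map_sub_lt _ ?_ (by simpa using ha)
    rwa [HeightOneSpectrum.valuation_lt_one_iff_mem]

end

/-- Were two distinct points to share an ideal, it would contain one of the nonzero constants x -
x', y - y', hence be the whole ring. -/
theorem affinePlace_injective {W : WeierstrassCurve.Affine k} {x y x' y' : k} (h : W.Nonsingular x y) (h' : W.Nonsingular x' y')
    (e : affinePlace W h = affinePlace W h') : x = x' ∧ y = y' := by
  have hP := (affinePlace W h).isPrime
  have e' : (affinePlace W h).asIdeal = (affinePlace W h').asIdeal := by rw [e]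
  have hc : ∀ c : k, algebraMap k _ c ∈ (affinePlace W h).asIdeal → c = 0 := by
    intro c hc
    by_contra h0
    refine hP.ne_top ?_
    exact Ideal.eq_top_of_isUnit_mem _ hc ((isUnit_iff_ne_zero.mpr h0).map (algebraMap k _))
  have hx : CoordinateRing.XClass W x ∈ (affinePlace W h).asIdeal :=
    Ideal.subset_span (by simp)
  have hx' : CoordinateRing.XClass W x' ∈ (affinePlace W h).asIdeal :=
    e' ▸ Ideal.subset_span (by simp)
  have hy : CoordinateRing.YClass W (C y) ∈ (affinePlace W h).asIdeal :=
    Ideal.subset_span (by simp)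
  have hy' : CoordinateRing.YClass W (C y') ∈ (affinePlace W h).asIdeal :=
    e' ▸ Ideal.subset_span (by simp)
  constructor
  · have := hc (x - x') (by
      convert sub_mem hx' hx using 1
      rw [CoordinateRing.XClass, CoordinateRing.XClass, ← map_sub]
      change CoordinateRing.mk W (C (C (x - x'))) = _
      congr 1
      simp)
    exact sub_eq_zero.mp this
  · have := hc (y - y') (by
      convert sub_mem hy' hy using 1
      rw [CoordinateRing.YClass, CoordinateRing.YClass, ← map_sub]
      change CoordinateRing.mk W (C (C (y - y'))) = _
      congr 1
      simp)
    exact sub_eq_zero.mp this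

section

variable [IsAlgClosed k] {W : WeierstrassCurve.Affine k} [WeierstrassCurve.IsElliptic W]

attribute [local instance] isLocalization_functionField finite_functionField

/-! ### The degree of a principal divisor -/

/-- The ideals of P and -P multiply to (X - x), whose norm is (X - x)². Each of the two norms is a
positive power of (X - x), so both exponents are 1. -/
theorem relNorm_XYIdeal {x y : k} (h : W.Nonsingular x y) :
    Ideal.relNorm k[X] (CoordinateRing.XYIdeal W x (C y)) = Ideal.span {X - C x} := by
  have hmax : (Ideal.span {X - C x} : Ideal k[X]).IsMaximal :=
    PrincipalIdealRing.isMaximal_of_irreducible (irreducible_X_sub_C x)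
  have hX : Ideal.relNorm k[X] (CoordinateRing.XIdeal W x) = Ideal.span {X - C x} ^ 2 := by
    rw [CoordinateRing.XIdeal, Ideal.relNorm_singleton, Algebra.intNorm_eq_norm,
      Ideal.span_singleton_pow]
    congr 2
    exact Algebra.norm_algebraMap_of_basis (CoordinateRing.basis W) (X - C x)
  have key : ∀ {y' : k}, W.Nonsingular x y' → ∃ s, s ≠ 0 ∧
      Ideal.relNorm k[X] (CoordinateRing.XYIdeal W x (C y')) = Ideal.span {X - C x} ^ s := by
    intro y' h'
    have hP : (CoordinateRing.XYIdeal W x (C y')).IsPrime := (XYIdeal_isMaximal W h'.left).isPrime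
    have hle : Ideal.span {X - C x} ≤
        (CoordinateRing.XYIdeal W x (C y')).comap (algebraMap k[X] W.CoordinateRing) := by
      rw [Ideal.span_singleton_le_iff_mem]
      exact Ideal.subset_span (Set.mem_insert _ _)
    have heq := hmax.eq_of_le (Ideal.comap_ne_top _ hP.ne_top) hle
    have : (CoordinateRing.XYIdeal W x (C y')).LiesOver (Ideal.span {X - C x}) := ⟨heq⟩
    obtain ⟨s, hs⟩ := Ideal.exists_relNorm_eq_pow_of_isPrime
      (CoordinateRing.XYIdeal W x (C y')) (Ideal.span {X - C x})
    refine ⟨s, ?_, hs⟩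
    rintro rfl
    have := Ideal.relNorm_le_comap k[X] (CoordinateRing.XYIdeal W x (C y'))
    rw [hs, pow_zero, Ideal.one_eq_top, ← heq, top_le_iff] at this
    exact hmax.ne_top this
  obtain ⟨s, hs, e⟩ := key h
  obtain ⟨t, ht, e'⟩ := key ((WeierstrassCurve.Affine.nonsingular_neg ..).mpr h)
  have h2 := hX
  rw [← CoordinateRing.XYIdeal_neg_mul h, map_mul, e, e', ← pow_add] at h2
  have h0 : (Ideal.span {X - C x} : Ideal k[X]) ≠ 0 := by
    rw [Ne, Ideal.zero_eq_bot, Ideal.span_singleton_eq_bot]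
    exact X_sub_C_ne_zero x
  have h1 : ¬ IsUnit (Ideal.span {X - C x} : Ideal k[X]) := by
    rw [Ideal.isUnit_iff]
    exact hmax.ne_top
  have := (pow_inj_of_not_isUnit h1 h0).mp h2
  obtain rfl : s = 1 := by omega
  rw [e, pow_one]

variable (W) in
/-- The closed points of the projective curve: the point at infinity, and the maximal ideals of the
coordinate ring. -/
def placeOfPoint : W.Point → Option (HeightOneSpectrum W.CoordinateRing)
  | .zero => none
  | .some _ _ h => some (affinePlace W h)

theorem placeOfPoint_bijective : Function.Bijective (placeOfPoint W) := by
  constructor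
  · rintro (_ | ⟨x, y, h⟩) (_ | ⟨x', y', h'⟩) e
    · rfl
    · cases e
    · cases e
    · obtain ⟨rfl, rfl⟩ := affinePlace_injective h h' (Option.some.inj e)
      rfl
  · rintro (_ | v)
    · exact ⟨.zero, rfl⟩
    · have := v.isPrime
      obtain ⟨x, y, h, e⟩ := exists_XYIdeal_eq W v.asIdeal v.ne_bot
      exact ⟨.some x y (equation_iff_nonsingular.mp h),
        congrArg some (HeightOneSpectrum.ext e.symm)⟩

variable (W) in
/-- The bijection between the points of the curve and its places. -/
def placeEquiv : W.Point ≃ Option (HeightOneSpectrum W.CoordinateRing) :=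
  Equiv.ofBijective _ placeOfPoint_bijective

theorem relNorm_eq (v : HeightOneSpectrum W.CoordinateRing) :
    ∃ x : k, Ideal.relNorm k[X] v.asIdeal = Ideal.span {X - C x} := by
  have := v.isPrime
  obtain ⟨x, y, h, e⟩ := exists_XYIdeal_eq W v.asIdeal v.ne_bot
  exact ⟨x, e ▸ relNorm_XYIdeal (equation_iff_nonsingular.mp h)⟩

/-- The order of vanishing at a maximal ideal of the coordinate ring. -/
def ordPlace (v : HeightOneSpectrum W.CoordinateRing) (f : W.FunctionField) : ℤ :=
  -(v.valuation W.FunctionField f).log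

open Classical in
theorem ordPlace_algebraMap (v : HeightOneSpectrum W.CoordinateRing) {r : W.CoordinateRing}
    (hr : r ≠ 0) : ordPlace v (algebraMap _ _ r) =
      ((Associates.mk v.asIdeal).count (Associates.mk (Ideal.span {r})).factors : ℤ) := by
  rw [ordPlace, HeightOneSpectrum.valuation_of_algebraMap, HeightOneSpectrum.intValuation_if_neg _ hr,
    WithZero.log_exp, neg_neg]

theorem finite_ordPlace_algebraMap {r : W.CoordinateRing} (hr : r ≠ 0) :
    Function.HasFiniteSupport
      fun v : HeightOneSpectrum W.CoordinateRing => ordPlace v (algebraMap _ _ r) := by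
  classical
  have h := Associates.finite_factors (I := Ideal.span {r})
    (by rwa [Ne, Ideal.zero_eq_bot, Ideal.span_singleton_eq_bot])
  rw [Filter.eventually_cofinite] at h
  refine h.subset fun v hv => ?_
  rwa [Function.mem_support, ordPlace_algebraMap v hr] at hv

/-- Taking relative norms of the prime factorization of (r), each prime contributes one linear
factor, so the degree of the norm of r counts the affine zeros. It is also the pole order of r at
infinity, whence `finsum_ord`. -/
theorem finsum_ordPlace_algebraMap {r : W.CoordinateRing} (hr : r ≠ 0) :
    ∑ᶠ v : HeightOneSpectrum W.CoordinateRing, ordPlace v (algebraMap _ _ r) =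
      (Algebra.norm k[X] r).natDegree := by
  classical
  have hI : Ideal.span {r} ≠ 0 := by rwa [Ne, Ideal.zero_eq_bot, Ideal.span_singleton_eq_bot]
  set n : HeightOneSpectrum W.CoordinateRing → ℕ := fun v =>
    (Associates.mk v.asIdeal).count (Associates.mk (Ideal.span {r})).factors with hn
  have hfin : (Function.support n).Finite := by
    refine (finite_ordPlace_algebraMap hr).subset fun v hv => ?_
    rw [Function.mem_support, ordPlace_algebraMap v hr]
    exact_mod_cast hv
  choose a ha using relNorm_eq (W := W)
  have hprod : Ideal.span {r} = ∏ v ∈ hfin.toFinset, v.asIdeal ^ n v := by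
    rw [← finprod_eq_prod_of_mulSupport_subset]
    · exact (Ideal.finprod_heightOneSpectrum_factorization hI).symm
    · intro v hv
      rw [Function.mem_mulSupport] at hv
      rw [Set.Finite.coe_toFinset, Function.mem_support]
      intro h0
      rw [h0, pow_zero] at hv
      exact hv rfl
  have hnorm := congrArg (Ideal.relNorm k[X]) hprod
  simp only [map_prod, map_pow, ha, Ideal.relNorm_singleton, Algebra.intNorm_eq_norm,
    Ideal.span_singleton_pow, Ideal.prod_span_singleton] at hnorm
  rw [natDegree_eq_of_degree_eq (degree_eq_degree_of_associated
    (Ideal.span_singleton_eq_span_singleton.mp hnorm)),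
    natDegree_prod _ _ fun v _ => pow_ne_zero _ (X_sub_C_ne_zero _)]
  simp only [natDegree_pow, natDegree_X_sub_C, mul_one]
  rw [finsum_eq_sum_of_support_subset (s := hfin.toFinset)]
  · push_cast
    exact Finset.sum_congr rfl fun v _ => ordPlace_algebraMap v hr
  · intro v hv
    rw [Function.mem_support, ordPlace_algebraMap v hr] at hv
    rw [Set.Finite.coe_toFinset, Function.mem_support]
    exact_mod_cast hv

theorem ord_placeEquiv_symm_some (v : HeightOneSpectrum W.CoordinateRing) (f : W.FunctionField) :
    ord W ((placeEquiv W).symm (some v)) f = ordPlace v f := by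
  obtain ⟨P, hP⟩ := (placeEquiv W).surjective (some v)
  rw [← hP, Equiv.symm_apply_apply]
  cases P with
  | zero => cases hP
  | some x y h =>
    obtain rfl : affinePlace W h = v := Option.some.inj hP
    rfl

theorem hasFiniteSupport_of_ordPlace {f : W.FunctionField}
    (hf : Function.HasFiniteSupport
      fun v : HeightOneSpectrum W.CoordinateRing => ordPlace v f) :
    Function.HasFiniteSupport fun P : W.Point => ord W P f := by
  refine ((hf.image fun v => (placeEquiv W).symm (some v)).union (Set.finite_singleton 0)).subset
    fun P hP => ?_
  cases P with
  | zero => exact .inr rfl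
  | some x y h => exact .inl ⟨affinePlace W h, hP, (placeEquiv W).symm_apply_apply (.some x y h)⟩

theorem finsum_ord_eq {f : W.FunctionField}
    (hf : Function.HasFiniteSupport
      fun v : HeightOneSpectrum W.CoordinateRing => ordPlace v f) :
    ∑ᶠ P : W.Point, ord W P f = ord W .zero f +
      ∑ᶠ v : HeightOneSpectrum W.CoordinateRing, ordPlace v f := by
  rw [← finsum_comp_equiv (placeEquiv W).symm, finsum_option]
  · simp only [ord_placeEquiv_symm_some]
    rw [show (placeEquiv W).symm none = .zero from (placeEquiv W).symm_apply_apply .zero]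
  · simpa only [Function.comp_def, ord_placeEquiv_symm_some] using hf

theorem finite_support_ord {f : W.FunctionField} (hf : f ≠ 0) :
    Function.HasFiniteSupport fun P : W.Point => ord W P f := by
  obtain ⟨r, d, hd, rfl⟩ := exists_eq_div f
  have hr : r ≠ 0 := by rintro rfl; simp at hf
  have hd' : algebraMap k[X] W.CoordinateRing d ≠ 0 := by
    rwa [Ne, FaithfulSMul.algebraMap_eq_zero_iff]
  rw [IsScalarTower.algebraMap_apply k[X] W.CoordinateRing W.FunctionField]
  refine ((hasFiniteSupport_of_ordPlace (finite_ordPlace_algebraMap hr)).union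
    (hasFiniteSupport_of_ordPlace (finite_ordPlace_algebraMap hd'))).subset fun P hP => ?_
  by_contra hcon
  simp only [Set.mem_union, Function.mem_support, not_or, not_not] at hcon
  rw [Function.mem_support, ord_div P (by rwa [Ne, FaithfulSMul.algebraMap_eq_zero_iff])
    (by rwa [Ne, FaithfulSMul.algebraMap_eq_zero_iff]), hcon.1, hcon.2] at hP
  exact hP rfl

/-- A principal divisor has degree zero. -/
theorem finsum_ord {f : W.FunctionField} (hf : f ≠ 0) : ∑ᶠ P : W.Point, ord W P f = 0 := by
  have key : ∀ r : W.CoordinateRing, r ≠ 0 →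
      ∑ᶠ P : W.Point, ord W P (algebraMap _ W.FunctionField r) = 0 := by
    intro r hr
    rw [finsum_ord_eq (finite_ordPlace_algebraMap hr), finsum_ordPlace_algebraMap hr,
      ord_zero_algebraMap, neg_add_cancel]
  obtain ⟨r, d, hd, rfl⟩ := exists_eq_div f
  have hr : r ≠ 0 := by rintro rfl; simp at hf
  have hd' : algebraMap k[X] W.CoordinateRing d ≠ 0 := by
    rwa [Ne, FaithfulSMul.algebraMap_eq_zero_iff]
  have hrK : algebraMap W.CoordinateRing W.FunctionField r ≠ 0 := by
    rwa [Ne, FaithfulSMul.algebraMap_eq_zero_iff]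
  have hdK : algebraMap W.CoordinateRing W.FunctionField (algebraMap k[X] _ d) ≠ 0 := by
    rwa [Ne, FaithfulSMul.algebraMap_eq_zero_iff]
  rw [IsScalarTower.algebraMap_apply k[X] W.CoordinateRing W.FunctionField]
  simp only [ord_div _ hrK hdK]
  rw [finsum_sub_distrib (finite_support_ord hrK) (finite_support_ord hdK), key r hr, key _ hd',
    sub_zero]

/-! ### Functions with a prescribed divisor -/

/-- Translates orders of vanishing into exponents of fractional ideals, so that a generator of a
principal product of `pointIdeal`s has a known affine divisor. -/
theorem count_spanSingleton (v : HeightOneSpectrum W.CoordinateRing) {f : W.FunctionField}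
    (hf : f ≠ 0) :
    FractionalIdeal.count W.FunctionField v (FractionalIdeal.spanSingleton W.CoordinateRing⁰ f) =
      ordPlace v f := by
  classical
  obtain ⟨r, d, hd, rfl⟩ := exists_eq_div f
  have hr : r ≠ 0 := by rintro rfl; simp at hf
  have hd' : algebraMap k[X] W.CoordinateRing d ≠ 0 := by
    rwa [Ne, FaithfulSMul.algebraMap_eq_zero_iff]
  rw [IsScalarTower.algebraMap_apply k[X] W.CoordinateRing W.FunctionField] at hf ⊢
  generalize algebraMap k[X] W.CoordinateRing d = s at *
  have h1 : v.valuation W.FunctionField (algebraMap _ _ r) ≠ 0 := by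
    rwa [Valuation.ne_zero_iff, Ne, FaithfulSMul.algebraMap_eq_zero_iff]
  have h2 : v.valuation W.FunctionField (algebraMap _ _ s) ≠ 0 := by
    rwa [Valuation.ne_zero_iff, Ne, FaithfulSMul.algebraMap_eq_zero_iff]
  have hord : ordPlace v (algebraMap _ W.FunctionField r / algebraMap _ W.FunctionField s) =
      ordPlace v (algebraMap _ _ r) - ordPlace v (algebraMap _ _ s) := by
    simp only [ordPlace, map_div₀]
    rw [WithZero.log_div h1 h2]
    ring
  rw [hord, ordPlace_algebraMap v hr, ordPlace_algebraMap v hd']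
  apply FractionalIdeal.count_well_defined
  · rwa [Ne, FractionalIdeal.spanSingleton_eq_zero_iff]
  · rw [FractionalIdeal.coeIdeal_span_singleton, FractionalIdeal.spanSingleton_mul_spanSingleton,
      div_eq_inv_mul]

variable (W) in
/-- The fractional ideal of the functions on the affine curve vanishing at a given point. -/
def pointIdeal : W.Point → (FractionalIdeal W.CoordinateRing⁰ W.FunctionField)ˣ
  | .zero => 1
  | .some _ _ h => CoordinateRing.XYIdeal' (W := W) h

theorem toClass_eq_mk_pointIdeal [DecidableEq k] (P : W.Point) :
    Point.toClass P = Additive.ofMul (ClassGroup.mk W.FunctionField (pointIdeal W P)) := by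
  cases P with
  | zero => exact (congrArg Additive.ofMul (map_one (ClassGroup.mk W.FunctionField))).symm
  | some x y h => rfl

open Classical in
theorem count_pointIdeal {x y : k} (h : W.Nonsingular x y) (P : W.Point) :
    FractionalIdeal.count W.FunctionField (affinePlace W h)
      (pointIdeal W P : FractionalIdeal W.CoordinateRing⁰ W.FunctionField) =
      if P = .some x y h then 1 else 0 := by
  cases P with
  | zero =>
    rw [if_neg (by rintro ⟨⟩)]
    exact FractionalIdeal.count_one _ _
  | some x' y' h' =>
    refine (FractionalIdeal.count_maximal W.FunctionField (affinePlace W h)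
      (affinePlace W h')).trans ?_
    congr 1
    rw [eq_iff_iff]
    constructor
    · intro e
      obtain ⟨rfl, rfl⟩ := affinePlace_injective h' h e
      rfl
    · intro e
      cases e
      rfl

/-- A divisor of degree zero whose points sum to zero is principal. -/
theorem exists_ord_eq [DecidableEq k] (D : W.Point →₀ ℤ) (hdeg : (D.sum fun _ n => n) = 0)
    (hsum : (D.sum fun P n => n • P) = 0) :
    ∃ f : W.FunctionField, f ≠ 0 ∧ ∀ P, ord W P f = D P := by
  classical
  set U : (FractionalIdeal W.CoordinateRing⁰ W.FunctionField)ˣ :=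
    ∏ P ∈ D.support, pointIdeal W P ^ D P with hU
  have hU1 : ClassGroup.mk W.FunctionField U = 1 := by
    -- `Point.toClass` is a homomorphism, so the vanishing of the sum of points says that the
    -- product of their ideals has trivial class.
    have h := congrArg Point.toClass hsum
    rw [map_zero, Finsupp.sum, map_sum] at h
    simp only [map_zsmul, toClass_eq_mk_pointIdeal] at h
    rw [hU, map_prod]
    simp only [map_zpow]
    exact h
  rw [ClassGroup.mk_eq_one_iff] at hU1
  obtain ⟨f, hf⟩ := hU1
  have hUf : (U : FractionalIdeal W.CoordinateRing⁰ W.FunctionField) =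
      FractionalIdeal.spanSingleton _ f := by
    rw [← FractionalIdeal.coeToSubmodule_inj, FractionalIdeal.coe_spanSingleton]
    exact hf
  have hf0 : f ≠ 0 := by
    rintro rfl
    exact U.ne_zero (by rw [hUf, FractionalIdeal.spanSingleton_zero])
  have haff : ∀ P : W.Point, P ≠ 0 → ord W P f = D P := by
    intro P hP
    cases P with
    | zero => exact absurd rfl hP
    | some x y h =>
      change ordPlace (affinePlace W h) f = _
      rw [← count_spanSingleton _ hf0, ← hUf, hU, Units.coe_prod, FractionalIdeal.count_prod]
      · simp only [Units.val_zpow_eq_zpow_val, FractionalIdeal.count_zpow, count_pointIdeal]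
        simpa using Eq.symm
      · intro Q _
        exact (pointIdeal W Q ^ D Q).ne_zero
  refine ⟨f, hf0, fun P => ?_⟩
  by_cases hP : P = 0
  · subst hP
    have hD : Function.HasFiniteSupport fun P => D P := D.hasFiniteSupport
    -- The ideal says nothing about infinity; the order there is forced because both divisors have
    -- degree zero and agree elsewhere.
    have h1 : ∑ᶠ P, (ord W P f - D P) = 0 := by
      rw [finsum_sub_distrib (finite_support_ord hf0) hD, finsum_ord hf0, zero_sub, neg_eq_zero,
        ← hdeg]
      exact finsum_eq_sum_of_support_subset _ (by simp)
    rw [finsum_eq_single _ 0 fun P hP => sub_eq_zero.mpr (haff P hP)] at h1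
    exact sub_eq_zero.mp h1
  · exact haff P hP

end

/-! ### Divisors as finitely supported functions, and degree bounds -/

section Divisor

open Classical in
/-- An effective divisor of positive degree contains a point. -/
theorem exists_single_le {α : Type*} {D : α →₀ ℤ} (hD : 0 ≤ D) (h : 0 < D.degree) :
    ∃ P, Finsupp.single P 1 ≤ D := by
  obtain ⟨P, hP⟩ : ∃ P, D P ≠ 0 := by
    by_contra! h0
    have : D = 0 := Finsupp.ext h0
    simp [this] at h
  refine ⟨P, fun Q => ?_⟩
  have h1 : 0 ≤ D Q := hD Q
  rw [Finsupp.single_apply]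
  split_ifs with hPQ
  · subst hPQ
    omega
  · exact h1

theorem eq_zero_of_degree_eq_zero {α : Type*} {D : α →₀ ℤ} (hD : 0 ≤ D) (h : D.degree = 0) :
    D = 0 := by
  rw [Finsupp.degree_apply, Finset.sum_eq_zero_iff_of_nonneg fun P _ => hD P] at h
  ext P
  by_contra h0
  exact h0 (h P (Finsupp.mem_support_iff.mpr h0))

/-- Names the last unknown point of a divisor that is known up to an effective remainder of degree
one. -/
theorem exists_eq_single {α : Type*} {D : α →₀ ℤ} (hD : 0 ≤ D) (h : D.degree = 1) :
    ∃ P, D = Finsupp.single P 1 := by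
  obtain ⟨P, hP⟩ := exists_single_le hD (by omega)
  refine ⟨P, sub_eq_zero.mp (eq_zero_of_degree_eq_zero (sub_nonneg.mpr hP) ?_)⟩
  rw [map_sub, h, Finsupp.degree_single, sub_self]

variable [IsAlgClosed k] {W : WeierstrassCurve.Affine k} [WeierstrassCurve.IsElliptic W]

variable (W) in
/-- The divisor of a rational function. -/
def divisor (f : W.FunctionField) : W.Point →₀ ℤ :=
  Finsupp.ofSupportFinite (fun P => ord W P f) (by
    rcases eq_or_ne f 0 with rfl | hf
    · have : (fun P => ord W P 0) = fun _ => 0 := by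
        ext P
        simpa using ord_algebraMap P (0 : k)
      rw [this]
      simp
    · exact finite_support_ord hf)

theorem divisor_apply (f : W.FunctionField) (P : W.Point) : divisor W f P = ord W P f := rfl

theorem degree_divisor {f : W.FunctionField} (hf : f ≠ 0) : (divisor W f).degree = 0 := by
  rw [← finsum_ord hf, Finsupp.degree_apply]
  exact (finsum_eq_sum_of_support_subset _ (by
    intro P hP
    exact Finsupp.mem_support_iff.mpr hP)).symm

theorem divisor_mul {f g : W.FunctionField} (hf : f ≠ 0) (hg : g ≠ 0) :
    divisor W (f * g) = divisor W f + divisor W g :=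
  Finsupp.ext fun P => ord_mul P hf hg

theorem divisor_div {f g : W.FunctionField} (hf : f ≠ 0) (hg : g ≠ 0) :
    divisor W (f / g) = divisor W f - divisor W g :=
  Finsupp.ext fun P => ord_div P hf hg

theorem divisor_neg (f : W.FunctionField) : divisor W (-f) = divisor W f :=
  Finsupp.ext fun P => ord_neg P f

theorem divisor_algebraMap (c : k) : divisor W (algebraMap k _ c) = 0 :=
  Finsupp.ext fun P => ord_algebraMap P c

theorem divisor_one : divisor W (1 : W.FunctionField) = 0 :=
  Finsupp.ext fun P => ord_one P

theorem divisor_const_mul {c : k} (hc : c ≠ 0) {f : W.FunctionField} (hf : f ≠ 0) :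
    divisor W (algebraMap k _ c * f) = divisor W f := by
  rw [divisor_mul ((_root_.map_ne_zero _).mpr hc) hf, divisor_algebraMap, zero_add]

theorem degree_posPart_divisor (f : W.FunctionField) :
    (divisor W f)⁺.degree = degree W f := by
  have h : ∀ P, (divisor W f)⁺ P = ((ord W P f).toNat : ℤ) := fun P => by
    rw [Int.toNat_eq_max]; rfl
  rw [degree, Finsupp.degree_apply, finsum_eq_sum_of_support_subset (s := (divisor W f)⁺.support)]
  · push_cast [h]
    rfl
  · intro P hP
    rw [Finset.mem_coe, Finsupp.mem_support_iff, h]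
    exact_mod_cast hP

theorem degree_negPart_divisor {f : W.FunctionField} (hf : f ≠ 0) :
    (divisor W f)⁻.degree = degree W f := by
  have h := congrArg Finsupp.degree (posPart_sub_negPart (divisor W f))
  rw [map_sub, degree_divisor hf, degree_posPart_divisor] at h
  omega

/-- A function whose poles are bounded by an effective divisor of degree `n` has degree at most
`n`. -/
theorem degree_le_of_nonneg {f : W.FunctionField} (hf : f ≠ 0) {E : W.Point →₀ ℤ} (hE : 0 ≤ E)
    (h : 0 ≤ divisor W f + E) {n : ℕ} (hn : E.degree = n) : degree W f ≤ n := by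
  have hle : 0 ≤ E - (divisor W f)⁻ := by
    rw [sub_nonneg, negPart_def]
    exact sup_le (neg_le_iff_add_nonneg'.mpr h) hE
  have : 0 ≤ (E - (divisor W f)⁻).degree := by
    rw [Finsupp.degree_apply]
    exact Finset.sum_nonneg fun P _ => hle P
  rw [map_sub, degree_negPart_divisor hf] at this
  omega

/-- `A` and `B` may overlap, since cancellation only lowers the degree; no coincidences between
points have to be excluded when this bound is used. -/
theorem degree_le_of_divisor_eq_sub {f : W.FunctionField} (hf : f ≠ 0) {A B : W.Point →₀ ℤ}
    (hA : 0 ≤ A) (hB : 0 ≤ B) (h : divisor W f = A - B) {n : ℕ} (hn : B.degree = n) :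
    degree W f ≤ n :=
  degree_le_of_nonneg hf hB (by rwa [h, sub_add_cancel]) hn

theorem negPart_divisor_one_sub_le {f : W.FunctionField} (hf1 : f ≠ 1) :
    (divisor W (1 - f))⁻ ≤ (divisor W f)⁻ := by
  intro P
  change max (-ord W P (1 - f)) 0 ≤ max (-ord W P f) 0
  have := le_ord_add P (f := 1) (g := -f) (m := min (ord W P f) 0)
    (.inr (by rw [ord_one]; exact min_le_right _ _)) (.inr (by rw [ord_neg]; exact min_le_left _ _))
  rw [← sub_eq_add_neg, sub_eq_zero] at this
  have := this.resolve_left hf1.symm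
  omega

/-- The functions `f` and `1 - f` have the same poles. -/
theorem negPart_divisor_one_sub {f : W.FunctionField} (hf : f ≠ 0) (hf1 : f ≠ 1) :
    (divisor W (1 - f))⁻ = (divisor W f)⁻ := by
  refine le_antisymm (negPart_divisor_one_sub_le hf1) ?_
  have := negPart_divisor_one_sub_le (W := W)
    (fun h => hf (by simpa using h) : 1 - f ≠ 1)
  rwa [sub_sub_cancel] at this

/-- The constant is the value at P of f/g, a unit there: it matches the leading terms. At a simple
pole this cancels the whole polar part. -/
theorem exists_sub_const_mul (P : W.Point) {f g : W.FunctionField} (hf : f ≠ 0) (hg : g ≠ 0)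
    (h : ord W P f = ord W P g) : ∃ c : k, c ≠ 0 ∧ (f - algebraMap k _ c * g = 0 ∨
      ord W P f < ord W P (f - algebraMap k _ c * g)) := by
  obtain ⟨c, hc⟩ := exists_sub_ord_pos P (f := f / g) (by rw [ord_div P hf hg, h, sub_self])
  refine ⟨c, ?_, ?_⟩
  · rintro rfl
    rw [map_zero, sub_zero, ord_div P hf hg, h, sub_self] at hc
    exact hc.elim (div_ne_zero hf hg) (lt_irrefl 0)
  · have e : f / g - algebraMap k _ c = (f - algebraMap k _ c * g) / g := by
      rw [sub_div, mul_div_cancel_right₀ _ hg]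
    rw [e, div_eq_zero_iff, or_iff_left hg] at hc
    rcases eq_or_ne (f - algebraMap k _ c * g) 0 with h0 | h0
    · exact .inl h0
    · have := hc.resolve_left h0
      rw [ord_div P h0 hg] at this
      exact .inr (by omega)

end Divisor

/-! ### Construction of the auxiliary function of degree at most three -/

section Auxiliary

variable [IsAlgClosed k] {W : WeierstrassCurve.Affine k} [WeierstrassCurve.IsElliptic W]

/-- Abel's theorem for divisors of the form `(a) + (b) + (c) - (d) - (e) - (f)`. -/
theorem exists_divisor_eq [DecidableEq k] {a b c d e f : W.Point}
    (h : a + b + c = d + e + f) : ∃ g : W.FunctionField, g ≠ 0 ∧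
      divisor W g = .single a 1 + .single b 1 + .single c 1
        - .single d 1 - .single e 1 - .single f 1 := by
  set D : W.Point →₀ ℤ := .single a 1 + .single b 1 + .single c 1
        - .single d 1 - .single e 1 - .single f 1 with hD
  let φ : (W.Point →₀ ℤ) →+ W.Point := Finsupp.liftAddHom fun P => (zmultiplesHom W.Point) P
  have hφ : ∀ P : W.Point, φ (.single P 1) = P := fun P => by
    simp [φ]
  obtain ⟨g, hg, hg'⟩ := exists_ord_eq D (by
    change D.degree = 0
    simp only [hD, map_add, map_sub, Finsupp.degree_single]
    norm_num) (by
    change φ D = 0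
    simp only [hD, map_add, map_sub, hφ]
    rw [h]
    abel)
  exact ⟨g, hg, Finsupp.ext hg'⟩

/-- A function with the same polar part as `h` at `β₁, β₂`, zeros at `γ₁, γ₂` and no further poles
besides `α₁, α₂`. -/
theorem exists_same_polar_part [DecidableEq k] {α₁ α₂ β₁ β₂ γ₁ γ₂ : W.Point} (hβ : β₁ ≠ β₂)
    (hα₁β₁ : α₁ ≠ β₁) (hα₁β₂ : α₁ ≠ β₂) (hα₂β₁ : α₂ ≠ β₁) (hα₂β₂ : α₂ ≠ β₂)
    (hγ₁β₁ : γ₁ ≠ β₁) (hγ₁β₂ : γ₁ ≠ β₂) (hγ₂β₁ : γ₂ ≠ β₁) (hγ₂β₂ : γ₂ ≠ β₂)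
    (hαγ : α₁ + α₂ ≠ γ₁ + γ₂) {h : W.FunctionField} (hh : h ≠ 0)
    (h₁ : ord W β₁ h = -1) (h₂ : ord W β₂ h = -1) :
    ∃ q : W.FunctionField, q ≠ 0 ∧ ord W β₁ q = -1 ∧ ord W β₂ q = -1 ∧
      .single γ₁ 1 + .single γ₂ 1 - .single β₁ 1 - .single β₂ 1 - .single α₁ 1 - .single α₂ 1 ≤
        divisor W q ∧
      (q - h = 0 ∨ 0 ≤ ord W β₁ (q - h)) ∧ (q - h = 0 ∨ 0 ≤ ord W β₂ (q - h)) := by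
  -- Each of q₁, q₂ is responsible for the pole at one βᵢ. The third zero is the one dictated by
  -- Abel's theorem.
  obtain ⟨q₁, hq₁, e₁⟩ := exists_divisor_eq (W := W) (a := γ₁) (b := γ₂)
    (c := β₂ + (α₁ + α₂) - (γ₁ + γ₂)) (d := β₂) (e := α₁) (f := α₂) (by abel)
  obtain ⟨q₂, hq₂, e₂⟩ := exists_divisor_eq (W := W) (a := γ₁) (b := γ₂)
    (c := β₁ + (α₁ + α₂) - (γ₁ + γ₂)) (d := β₁) (e := α₁) (f := α₂) (by abel)
  -- The third zero must not cancel the pole at β₂; this is exactly α₁ + α₂ ≠ γ₁ + γ₂.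
  have hv₁ : β₂ + (α₁ + α₂) - (γ₁ + γ₂) ≠ β₂ := fun e => hαγ (by
    rw [add_sub_assoc, add_eq_left, sub_eq_zero] at e
    exact e)
  have hv₂ : β₁ + (α₁ + α₂) - (γ₁ + γ₂) ≠ β₁ := fun e => hαγ (by
    rw [add_sub_assoc, add_eq_left, sub_eq_zero] at e
    exact e)
  generalize β₂ + (α₁ + α₂) - (γ₁ + γ₂) = v₁ at *
  generalize β₁ + (α₁ + α₂) - (γ₁ + γ₂) = v₂ at *
  have hpos : ∀ P Q : W.Point, (0 : ℤ) ≤ Finsupp.single P (1 : ℤ) Q := fun P Q => by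
    rw [Finsupp.single_apply]; split_ifs <;> simp
  have o₁₁ : 0 ≤ ord W β₁ q₁ := by
    rw [← divisor_apply, e₁]
    simp [Finsupp.single_apply, *]
    split_ifs <;> simp
  have o₂₂ : 0 ≤ ord W β₂ q₂ := by
    rw [← divisor_apply, e₂]
    simp [Finsupp.single_apply, *]
    split_ifs <;> simp
  have o₁₂ : ord W β₂ q₁ = -1 := by
    rw [← divisor_apply, e₁]
    simp [*]
  have o₂₁ : ord W β₁ q₂ = -1 := by
    rw [← divisor_apply, e₂]
    simp [*]
  -- Scale q₁ and q₂ to match the polar parts of h at β₂ and β₁. Since each is regular at the other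
  -- β, the sum r + s of the scaled functions matches h at both.
  obtain ⟨a, ha, ha'⟩ := exists_sub_const_mul β₂ hh hq₁ (h₂.trans o₁₂.symm)
  obtain ⟨b, hb, hb'⟩ := exists_sub_const_mul β₁ hh hq₂ (h₁.trans o₂₁.symm)
  have ea := divisor_const_mul (W := W) ha hq₁
  have eb := divisor_const_mul (W := W) hb hq₂
  have hq₁' : algebraMap k _ a * q₁ ≠ 0 := mul_ne_zero ((_root_.map_ne_zero _).mpr ha) hq₁
  have hq₂' : algebraMap k _ b * q₂ ≠ 0 := mul_ne_zero ((_root_.map_ne_zero _).mpr hb) hq₂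
  rw [← ea] at e₁
  rw [← eb] at e₂
  rw [← divisor_apply, ← ea, divisor_apply] at o₁₁
  rw [← divisor_apply, ← eb, divisor_apply] at o₂₂
  generalize algebraMap k _ a * q₁ = r at *
  generalize algebraMap k _ b * q₂ = s at *
  have d₁ : r + s - h = 0 ∨ 0 ≤ ord W β₁ (r + s - h) := by
    have := le_ord_add β₁ (f := r) (g := -(h - s)) (m := 0) (.inr o₁₁) (by
      rw [ord_neg, neg_eq_zero]
      exact hb'.imp id fun h' => by omega)
    convert this using 2
    · ring
    · congr 1; ring
  have d₂ : r + s - h = 0 ∨ 0 ≤ ord W β₂ (r + s - h) := by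
    have := le_ord_add β₂ (f := s) (g := -(h - r)) (m := 0) (.inr o₂₂) (by
      rw [ord_neg, neg_eq_zero]
      exact ha'.imp id fun h' => by omega)
    convert this using 2
    · ring
    · congr 1; ring
  have hlow : ∀ P, r + s = 0 ∨ (.single γ₁ 1 + .single γ₂ 1 - .single β₁ 1 - .single β₂ 1 -
      .single α₁ 1 - .single α₂ 1 : W.Point →₀ ℤ) P ≤ ord W P (r + s) := by
    intro P
    apply le_ord_add
    · right
      rw [← divisor_apply, e₁]
      have := hpos v₁ P
      have := hpos β₁ P
      simp only [Finsupp.add_apply, Finsupp.sub_apply]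
      omega
    · right
      rw [← divisor_apply, e₂]
      have := hpos v₂ P
      have := hpos β₂ P
      simp only [Finsupp.add_apply, Finsupp.sub_apply]
      omega
  -- A function that differs from h by something regular at P must retain the pole of h at P.
  have hlt : ∀ P, ord W P h = -1 → (r + s - h = 0 ∨ 0 ≤ ord W P (r + s - h)) →
      r + s ≠ 0 ∧ ord W P (r + s) ≤ -1 := by
    intro P hP hd
    by_contra hcon
    have h3 : r + s = 0 ∨ 0 ≤ ord W P (r + s) := by
      rw [or_iff_not_imp_left]
      intro h0
      by_contra h4
      exact hcon ⟨h0, by omega⟩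
    have := le_ord_add P (f := r + s) (g := -(r + s - h)) h3 (by rwa [ord_neg, neg_eq_zero])
    rw [show r + s + -(r + s - h) = h by ring] at this
    have := this.resolve_left hh
    omega
  obtain ⟨hq0, l₁⟩ := hlt β₁ h₁ d₁
  obtain ⟨-, l₂⟩ := hlt β₂ h₂ d₂
  refine ⟨r + s, hq0, le_antisymm l₁ ?_, le_antisymm l₂ ?_,
    fun P => (hlow P).resolve_left hq0, d₁, d₂⟩
  · have := (hlow β₁).resolve_left hq0
    simpa [Finsupp.single_apply, hβ.symm, *] using this
  · have := (hlow β₂).resolve_left hq0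
    simpa [Finsupp.single_apply, *] using this

/-- A function of degree at most three vanishing at `α₁, α₂`, with value one at `β₁, β₂` and
poles at `γ₁, γ₂`. -/
theorem exists_auxiliary [DecidableEq k] {α₁ α₂ β₁ β₂ γ₁ γ₂ : W.Point} (hβ : β₁ ≠ β₂)
    (hα₁β₁ : α₁ ≠ β₁) (hα₁β₂ : α₁ ≠ β₂) (hα₂β₁ : α₂ ≠ β₁) (hα₂β₂ : α₂ ≠ β₂)
    (hγ₁β₁ : γ₁ ≠ β₁) (hγ₁β₂ : γ₁ ≠ β₂) (hγ₂β₁ : γ₂ ≠ β₁) (hγ₂β₂ : γ₂ ≠ β₂)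
    (hα₁γ₁ : α₁ ≠ γ₁) (hα₁γ₂ : α₁ ≠ γ₂) (hα₂γ₁ : α₂ ≠ γ₁) (hα₂γ₂ : α₂ ≠ γ₂)
    (hαγ : α₁ + α₂ ≠ γ₁ + γ₂) :
    ∃ (g : W.FunctionField) (δ ε ζ : W.Point), g ≠ 0 ∧ g ≠ 1 ∧
      divisor W g = .single α₁ 1 + .single α₂ 1 + .single δ 1
        - .single γ₁ 1 - .single γ₂ 1 - .single ε 1 ∧
      divisor W (1 - g) = .single β₁ 1 + .single β₂ 1 + .single ζ 1
        - .single γ₁ 1 - .single γ₂ 1 - .single ε 1 := by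
  have hpos : ∀ P Q : W.Point, (0 : ℤ) ≤ Finsupp.single P (1 : ℤ) Q := fun P Q => by
    rw [Finsupp.single_apply]; split_ifs <;> simp
  -- Only the simple poles at β₁, β₂ matter. The zero α₁ could be any point other than these two,
  -- and the two entries 0 are padding that cancels.
  obtain ⟨h, hh, eh⟩ := exists_divisor_eq (W := W) (a := α₁) (b := β₁ + β₂ - α₁) (c := 0)
    (d := β₁) (e := β₂) (f := 0) (by abel)
  rw [add_sub_right_comm, add_sub_right_comm, add_sub_cancel_right] at eh
  have hw₁ : β₁ + β₂ - α₁ ≠ β₁ := fun e => hα₁β₂ (by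
    rw [add_sub_assoc, add_eq_left, sub_eq_zero] at e
    exact e.symm)
  have hw₂ : β₁ + β₂ - α₁ ≠ β₂ := fun e => hα₁β₁ (by
    rw [add_sub_right_comm, add_eq_right, sub_eq_zero] at e
    exact e.symm)
  generalize β₁ + β₂ - α₁ = w at *
  have h₁ : ord W β₁ h = -1 := by
    rw [← divisor_apply, eh]
    simp [*]
  have h₂ : ord W β₂ h = -1 := by
    rw [← divisor_apply, eh]
    simp [*]
  obtain ⟨q, hq, q₁, q₂, hE, d₁, d₂⟩ := exists_same_polar_part hβ hα₁β₁ hα₁β₂ hα₂β₁ hα₂β₂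
    hγ₁β₁ hγ₁β₂ hγ₂β₁ hγ₂β₂ hαγ hh h₁ h₂
  -- The prescribed part of div(q) has degree 2 - 4 = -2, so two zeros remain: τ and then τ'.
  obtain ⟨τ, hτ⟩ := exists_single_le (sub_nonneg.mpr hE) (by
    simp only [map_add, map_sub, Finsupp.degree_single, degree_divisor hq]
    norm_num)
  -- The pole of q at β₁ has order exactly one, so the remainder of div(q) vanishes at β₁.
  have hτβ₁ : τ ≠ β₁ := by
    rintro rfl
    have := hτ τ
    simp [divisor_apply, *] at this
  have hτβ₂ : τ ≠ β₂ := by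
    rintro rfl
    have := hτ τ
    simp [divisor_apply, *] at this
  obtain ⟨τ', hτ'⟩ := exists_eq_single (sub_nonneg.mpr hτ) (by
    simp only [map_add, map_sub, Finsupp.degree_single, degree_divisor hq]
    norm_num)
  have eq : divisor W q = .single γ₁ 1 + .single γ₂ 1 + .single τ 1 + .single τ' 1
      - .single β₁ 1 - .single β₂ 1 - .single α₁ 1 - .single α₂ 1 := by
    rw [← hτ']
    abel
  -- Here c = h(τ), so that h - c vanishes at τ and the quotient by q loses that pole.
  obtain ⟨c, hc⟩ := exists_sub_ord_pos τ (f := h) (by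
    rw [← divisor_apply, eh]
    have := hpos α₁ τ
    have := hpos w τ
    simp [hτβ₁.symm, hτβ₂.symm, Finsupp.single_apply] at *
    omega)
  set p := h - algebraMap k _ c with hp
  have hp0 : p ≠ 0 := by
    intro h0
    rw [hp, sub_eq_zero] at h0
    rw [h0, ord_algebraMap] at h₁
    omega
  have hc' := hc.resolve_left hp0
  have hEp : .single τ 1 - .single β₁ 1 - .single β₂ 1 ≤ divisor W p := by
    intro P
    rcases eq_or_ne P τ with rfl | hP
    · simp [hτβ₁.symm, hτβ₂.symm, divisor_apply]
      omega
    · have a1 := hpos β₁ P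
      have a2 := hpos β₂ P
      have a3 := hpos α₁ P
      have a4 := hpos w P
      rw [divisor_apply, hp, sub_eq_add_neg]
      refine (le_ord_add P (.inr ?_) (.inr ?_)).resolve_left (by rwa [← sub_eq_add_neg])
      · rw [← divisor_apply, eh]
        simp [hP.symm, Finsupp.single_apply] at *
        omega
      · rw [ord_neg, ord_algebraMap]
        simp [hP.symm, Finsupp.single_apply] at *
        omega
  obtain ⟨δ, hδ⟩ := exists_eq_single (sub_nonneg.mpr hEp) (by
    simp only [map_sub, Finsupp.degree_single, degree_divisor hp0]
    norm_num)
  have eg : divisor W (p / q) = .single α₁ 1 + .single α₂ 1 + .single δ 1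
        - .single γ₁ 1 - .single γ₂ 1 - .single τ' 1 := by
    rw [divisor_div hp0 hq, eq, ← hδ]
    abel
  have hg0 : p / q ≠ 0 := div_ne_zero hp0 hq
  -- If p/q were 1, the zeros at α₁ and α₂ would have to cancel against poles; both differ from γ₁
  -- and γ₂, and the single pole τ' cannot cancel both.
  have hg1 : p / q ≠ 1 := by
    intro h1
    rw [h1, divisor_one] at eg
    have b1 := DFunLike.congr_fun eg α₁
    have b2 := DFunLike.congr_fun eg α₂
    have b3 := hpos δ α₁
    have b4 := hpos δ α₂
    simp [Finsupp.single_apply, hα₁γ₁.symm, hα₁γ₂.symm, hα₂γ₁.symm, hα₂γ₂.symm] at b1 b2 b3 b4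
    by_cases c1 : τ' = α₁
    · by_cases c2 : τ' = α₂
      · subst c1
        subst c2
        simp at b1
        split_ifs at b1 <;> omega
      · split_ifs at * <;> omega
    · split_ifs at * <;> omega
  have hsub : 1 - p / q = (q - h + algebraMap k _ c) / q := by
    rw [hp]
    field_simp
    ring
  have hn0 : q - h + algebraMap k _ c ≠ 0 := by
    intro h0
    rw [h0, zero_div, sub_eq_zero] at hsub
    exact hg1 hsub.symm
  have hE1 : .single β₁ 1 + .single β₂ 1 - .single γ₁ 1 - .single γ₂ 1 - .single τ' 1 ≤
      divisor W (1 - p / q) := by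
    intro P
    have a1 := hpos τ' P
    -- At β₁ and β₂ the numerator q - h + c is regular while q has a simple pole, so 1 - p/q
    -- vanishes.
    have key : ord W P q = -1 → (q - h = 0 ∨ 0 ≤ ord W P (q - h)) →
        1 ≤ ord W P (1 - p / q) := by
      intro hPq hd
      rw [hsub, ord_div P hn0 hq, hPq]
      have := (le_ord_add P (m := 0) hd
        (.inr (by rw [ord_algebraMap] : (0 : ℤ) ≤ ord W P (algebraMap k _ c)))).resolve_left hn0
      omega
    rcases eq_or_ne P β₁ with rfl | hP₁
    · have := key q₁ d₁
      rw [divisor_apply]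
      simp [Finsupp.single_apply, *] at *
      omega
    rcases eq_or_ne P β₂ with rfl | hP₂
    · have := key q₂ d₂
      rw [divisor_apply]
      simp [Finsupp.single_apply, *] at *
      omega
    have a2 := hpos γ₁ P
    have a3 := hpos γ₂ P
    have a4 := hpos α₁ P
    have a5 := hpos α₂ P
    have a6 := hpos δ P
    rw [divisor_apply, sub_eq_add_neg 1]
    have z₁ : Finsupp.single β₁ (1 : ℤ) P = 0 := by simp [hP₁.symm]
    have z₂ : Finsupp.single β₂ (1 : ℤ) P = 0 := by simp [hP₂.symm]
    refine (le_ord_add P (.inr ?_) (.inr ?_)).resolve_left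
      (by rw [← sub_eq_add_neg]; exact sub_ne_zero.mpr hg1.symm)
    · rw [ord_one]
      simp only [Finsupp.add_apply, Finsupp.sub_apply]
      omega
    · rw [ord_neg, ← divisor_apply, eg]
      simp only [Finsupp.add_apply, Finsupp.sub_apply]
      omega
  obtain ⟨ζ, hζ⟩ := exists_eq_single (sub_nonneg.mpr hE1) (by
    simp only [map_add, map_sub, Finsupp.degree_single,
      degree_divisor (sub_ne_zero.mpr hg1.symm)]
    norm_num)
  refine ⟨p / q, δ, τ', ζ, hg0, hg1, eg, ?_⟩
  rw [← hζ]
  abel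

end Auxiliary

/-! ### The five-term relation for a generic function -/

section Generic

/-- The last hypothesis is the multiplicity requirement for coincident points. Applied to -div(f),
the lemma also handles poles. -/
theorem single_add_single_le_posPart {α : Type*} {D : α →₀ ℤ} {P Q : α} (hP : 0 < D P)
    (hQ : 0 < D Q) (h : P = Q → 2 ≤ D P) :
    .single P 1 + .single Q 1 ≤ D⁺ := by
  classical
  intro R
  change _ ≤ max (D R) 0
  rw [Finsupp.add_apply, Finsupp.single_apply, Finsupp.single_apply]
  split_ifs with h₁ h₂ h₂
  · subst h₁
    have := h h₂.symm
    omega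
  · subst h₁
    omega
  · subst h₂
    omega
  · omega

/-- The two signs cancel; the right-hand side has a divisor that can be read off from those of x, y,
1 - x and 1 - y. -/
theorem one_sub_inv_div_one_sub_inv {F : Type*} [Field F] {x y : F} (hx : x ≠ 0) (hy : y ≠ 0) :
    (1 - x⁻¹) / (1 - y⁻¹) = (1 - x) / x / ((1 - y) / y) := by
  have e : ∀ {z : F}, z ≠ 0 → 1 - z⁻¹ = -((1 - z) / z) := fun hz => by
    rw [sub_div, div_self hz, one_div, neg_sub]
  rw [e hx, e hy, neg_div_neg_eq]
variable [IsAlgClosed k] {W : WeierstrassCurve.Affine k} [WeierstrassCurve.IsElliptic W]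

theorem not_takesValue_zero_one {f : W.FunctionField} (P : W.Point) (h₀ : 0 < ord W P f)
    (h₁ : 0 < ord W P (f - 1)) : False := by
  have := le_ord_add P (f := f) (g := -(f - 1)) (m := 1) (.inr h₀) (.inr (by rwa [ord_neg]))
  rw [show f + -(f - 1) = 1 by ring, ord_one] at this
  exact this.elim one_ne_zero (by norm_num)

theorem ord_sub_one_of_neg {f : W.FunctionField} (hf1 : f ≠ 1) (P : W.Point)
    (h : ord W P f < 0) : ord W P (f - 1) < 0 := by
  by_contra hcon
  have := le_ord_add P (f := f - 1) (g := 1) (m := 0) (.inr (by omega)) (.inr (ord_one P).ge)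
  rw [sub_add_cancel] at this
  rcases this with rfl | h0
  · have := ord_algebraMap (W := W) P (0 : k)
    rw [map_zero] at this
    omega
  · omega

/-- The class of `f` is a combination of the classes of `g` and of three quotients. -/
theorem mk_mem_filtration_of_degree_le {n : ℕ} (f g : Gen W.FunctionField) (h : f ≠ g)
    (h₁ : degree W g.1 ≤ n) (h₂ : degree W (g.1 / f.1) ≤ n)
    (h₃ : degree W ((1 - f.1) / (1 - g.1)) ≤ n)
    (h₄ : degree W ((1 - f.1⁻¹) / (1 - g.1⁻¹)) ≤ n) :
    PreBloch.mk f ∈ filtration W n := by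
  have hmem : ∀ u : Gen W.FunctionField, degree W u.1 ≤ n → PreBloch.mk u ∈ filtration W n :=
    fun u hu => AddSubgroup.subset_closure ⟨u, hu, rfl⟩
  have hrel : (QuotientAddGroup.mk (fiveTerm f g h) : PreBloch W.FunctionField) = 0 :=
    (QuotientAddGroup.eq_zero_iff _).mpr (AddSubgroup.subset_closure ⟨f, g, h, rfl⟩)
  have hrel' : PreBloch.mk f - PreBloch.mk g + PreBloch.mk (Gen.ratio f g h) +
      PreBloch.mk (Gen.ratio g.oneSub f.oneSub (Gen.oneSub_injective.ne h.symm)) -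
      PreBloch.mk (Gen.ratio g.inverse.oneSub f.inverse.oneSub
        (Gen.oneSub_injective.ne (Gen.inverse_injective.ne h.symm))) = 0 := hrel
  have e : PreBloch.mk f = PreBloch.mk g - PreBloch.mk (Gen.ratio f g h) -
      PreBloch.mk (Gen.ratio g.oneSub f.oneSub (Gen.oneSub_injective.ne h.symm)) +
      PreBloch.mk (Gen.ratio g.inverse.oneSub f.inverse.oneSub
        (Gen.oneSub_injective.ne (Gen.inverse_injective.ne h.symm))) := by
    rw [← sub_eq_zero, ← hrel']
    abel
  rw [e]
  exact add_mem (sub_mem (sub_mem (hmem _ h₁) (hmem _ h₂)) (hmem _ h₃)) (hmem _ h₄)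

end Generic

theorem mk_mem_filtration_of_isGeneric [IsAlgClosed k] [DecidableEq k]
    (W : WeierstrassCurve.Affine k) [WeierstrassCurve.IsElliptic W] (n : ℕ) (hn : 3 ≤ n)
    (f : Gen W.FunctionField) (hdeg : degree W f.1 = n + 1) (hf : IsGeneric W f.1) :
    PreBloch.mk f ∈ filtration W n := by
  obtain ⟨α₁, α₂, β₁, β₂, γ₁, γ₂, ⟨hα₁, hα₂⟩, ⟨hβ₁, hβ₂⟩, ⟨hγ₁, hγ₂⟩, ⟨hα, hγ⟩, hβ,
    ⟨-, hαγ, -⟩, -⟩ := hf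
  have hf0 := f.2.1
  have hf1 := f.2.2
  have hval0 : ∀ P, TakesValue W f.1 P 0 → 0 < ord W P f.1 := fun P hP => by
    rw [TakesValue, map_zero, sub_zero] at hP
    exact hP.resolve_left hf0
  have hval1 : ∀ P, TakesValue W f.1 P 1 → 0 < ord W P (f.1 - 1) := fun P hP => by
    rw [TakesValue, map_one] at hP
    exact hP.resolve_left hf1
  replace hα₁ := hval0 _ hα₁
  replace hα₂ := hval0 _ hα₂
  replace hβ₁ := hval1 _ hβ₁
  replace hβ₂ := hval1 _ hβ₂
  rw [HasPole] at hγ₁ hγ₂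
  have hne01 : ∀ {P Q : W.Point}, 0 < ord W P f.1 → 0 < ord W Q (f.1 - 1) → P ≠ Q := by
    rintro P _ h₀ h₁ rfl
    exact not_takesValue_zero_one P h₀ h₁
  have hne1 : ∀ {P Q : W.Point}, ord W P f.1 < 0 → 0 < ord W Q (f.1 - 1) → P ≠ Q := by
    rintro P _ h₀ h₁ rfl
    exact h₁.not_gt (ord_sub_one_of_neg hf1 P h₀)
  have hne0 : ∀ {P Q : W.Point}, 0 < ord W P f.1 → ord W Q f.1 < 0 → P ≠ Q := by
    rintro P _ h₀ h₁ rfl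
    exact h₁.not_gt h₀
  obtain ⟨g, δ, ε, ζ, hg0, hg1, eg, eg'⟩ := exists_auxiliary hβ (hne01 hα₁ hβ₁) (hne01 hα₁ hβ₂)
    (hne01 hα₂ hβ₁) (hne01 hα₂ hβ₂) (hne1 hγ₁ hβ₁) (hne1 hγ₁ hβ₂) (hne1 hγ₂ hβ₁) (hne1 hγ₂ hβ₂)
    (hne0 hα₁ hγ₁) (hne0 hα₁ hγ₂) (hne0 hα₂ hγ₁) (hne0 hα₂ hγ₂) hαγ
  have hs : ∀ P : W.Point, (0 : W.Point →₀ ℤ) ≤ .single P 1 := fun P =>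
    Finsupp.single_nonneg.mpr zero_le_one
  have hf1' : 1 - f.1 ≠ 0 := sub_ne_zero.mpr hf1.symm
  have hg1' : 1 - g ≠ 0 := sub_ne_zero.mpr hg1.symm
  have hZ := single_add_single_le_posPart (D := divisor W f.1) hα₁ hα₂ hα
  have hN : .single γ₁ 1 + .single γ₂ 1 ≤ (divisor W f.1)⁻ := by
    have := single_add_single_le_posPart (D := -divisor W f.1) (P := γ₁) (Q := γ₂)
      (neg_pos.mpr hγ₁) (neg_pos.mpr hγ₂) (fun h => by
        have := hγ h
        change 2 ≤ -ord W γ₁ f.1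
        omega)
    rwa [posPart_neg] at this
  have hO : .single β₁ 1 + .single β₂ 1 ≤ (divisor W (1 - f.1))⁺ := by
    rw [← neg_sub, divisor_neg]
    exact single_add_single_le_posPart hβ₁ hβ₂ fun h => absurd h hβ
  have ef := posPart_sub_negPart (divisor W f.1)
  have ef' := posPart_sub_negPart (divisor W (1 - f.1))
  -- With a common polar divisor N, div(f) = Z - N and div(1 - f) = O - N, so N drops out of the
  -- divisor of (1 - f)/f.
  rw [negPart_divisor_one_sub hf0 hf1] at ef'
  have dZ := degree_posPart_divisor f.1
  have dN := degree_negPart_divisor hf0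
  rw [hdeg] at dZ dN
  generalize (divisor W f.1)⁺ = Z at *
  generalize (divisor W f.1)⁻ = N at *
  generalize (divisor W (1 - f.1))⁺ = O at *
  have hadd : ∀ {A B : W.Point →₀ ℤ} (P : W.Point), A ≤ B → 0 ≤ B - A + .single P 1 :=
    fun P h => add_nonneg (sub_nonneg.mpr h) (hs P)
  -- Two shared points leave and one point of g enters: n + 1 - 2 + 1 = n. It suffices to count the
  -- polar side, so only the degrees of Z and N are needed.
  have hcount : ∀ (D : W.Point →₀ ℤ) (P Q R : W.Point), D.degree = ((n + 1 : ℕ) : ℤ) →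
      (D - (.single P 1 + .single Q 1) + .single R 1).degree = n := fun D P Q R h => by
    simp only [map_add, map_sub, Finsupp.degree_single, h]
    push_cast
    ring
  have hgdeg : degree W g ≤ 3 := by
    refine degree_le_of_divisor_eq_sub hg0 (add_nonneg (add_nonneg (hs α₁) (hs α₂)) (hs δ))
      (add_nonneg (add_nonneg (hs γ₁) (hs γ₂)) (hs ε)) (by rw [eg]; abel) ?_
    simp only [map_add, Finsupp.degree_single]
    norm_num
  -- The five-term element requires f ≠ g, which holds because deg g ≤ 3 ≤ n < deg f.
  have hfg : f ≠ ⟨g, hg0, hg1⟩ := by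
    intro h
    rw [h] at hdeg
    change degree W g = n + 1 at hdeg
    omega
  refine mk_mem_filtration_of_degree_le f ⟨g, hg0, hg1⟩ hfg (hgdeg.trans hn) ?_ ?_ ?_
  · refine degree_le_of_divisor_eq_sub (div_ne_zero hg0 hf0) (hadd δ hN) (hadd ε hZ) ?_
      (hcount _ _ _ _ dZ)
    rw [divisor_div hg0 hf0, eg, ← ef]
    abel
  · refine degree_le_of_divisor_eq_sub (div_ne_zero hf1' hg1') (hadd ε hO) (hadd ζ hN) ?_
      (hcount _ _ _ _ dN)
    rw [divisor_div hf1' hg1', eg', ← ef']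
    abel
  · refine (congrArg (degree W) (one_sub_inv_div_one_sub_inv hf0 hg0)).trans_le ?_
    have hu : (1 - f.1) / f.1 ≠ 0 := div_ne_zero hf1' hf0
    have hv : (1 - g) / g ≠ 0 := div_ne_zero hg1' hg0
    refine degree_le_of_divisor_eq_sub (div_ne_zero hu hv) (hadd δ hO) (hadd ζ hZ) ?_
      (hcount _ _ _ _ dZ)
    rw [divisor_div hu hv, divisor_div hf1' hf0, divisor_div hg1' hg0, eg, eg', ← ef, ← ef']
    abel

end EllipticBloch

end

theorem proposition4 {k : Type*} [Field k] [IsAlgClosed k] [CharZero k] [DecidableEq k]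
    (W : WeierstrassCurve.Affine k) [WeierstrassCurve.IsElliptic W] (n : ℕ) (hn : 3 ≤ n)
    (f : EllipticBloch.Gen W.FunctionField)
    (hdeg : EllipticBloch.degree W f.1 = n + 1)
    (hf : EllipticBloch.IsGeneric W f.1) :
    EllipticBloch.PreBloch.mk f ∈ EllipticBloch.filtration W n :=
  EllipticBloch.mk_mem_filtration_of_isGeneric W n hn f hdeg hf
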